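/- Let $(\Sigma,\mathcal T)$ be an ideally triangulated compact surface with boundary: $\Sigma$ is obtained from finitely many hexagons, each with three pairwise non-adjacent red sides and three black sides, by identifying the red sides in pairs by homeomorphisms. Let $E$ be the set of edges (images of red sides) and $B=\{1,\dots,n\}$ the set of boundary components (each a cyclic sequence of black sides). A discrete hyperbolic metric is a function $l:E\to(0,\infty)$; it realizes each face as the (unique) right-angled hyperbolic hexagon whose red sides have the given lengths, and its generalized combinatorial curvature $K:B\to(0,\infty)$ assigns to each boundary component its length, i.e. the sum of the lengths of its black sides. Fix a discrete hyperbolic metric $\tilde l\in\mathbb R^E_{>0}$ and a function $\bar K\in\mathbb R^n_{>0}$ on $B$. A function $w:B\to\mathbb R$ is admissible, $w\in\mathcal W=\mathcal W(\tilde l)$, if there is a discrete hyperbolic metric $l=w*\tilde l$ with $$\cosh\frac{l_{ij}}2=e^{w_i+w_j}\cosh\frac{\tilde l_{ij}}2$$ for every edge, where $i,j$ are the boundary components (possibly equal) at its two ends. For $w\in\mathcal W$ let $K(w)$ be the generalized combinatorial curvature of $w*\tilde l$ and $\Delta=\Delta(w)=(\partial K_i/\partial w_j)_{n\times n}$. (1)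 For every $w\in\mathcal W$, $K$ is differentiable at $w$ and $-\Delta(w)$ is symmetric positive definite. Hence, for $s\in\mathbb R$, the operator $\Delta^s=-(-\Delta)^s$ is well defined, where $A^s=P^T\mathrm{diag}\{\lambda_1^s,\dots,\lambda_n^s\}P$ for a symmetric positive definite $A=P^T\mathrm{diag}\{\lambda_1,\dots,\lambda_n\}P$ with $P\in O(n)$. (2) On $\mathcal W$, the vector field $\Delta^s(\bar K-K)$ is $K-\bar K$ for $s=0$ (combinatorial Yamabe flow) and $\Delta(\bar K-K)$ for $s=1$ (combinatorial Calabi flow). (3) There is exactly one $\bar w\in\mathcal W$ with $K(\bar w)=\bar K$. For every $s\in\mathbb R$ and every $w_0\in\mathcal W$, the fractional combinatorial Calabi flow $$\frac{dw}{dt}=\Delta^s(\bar K-K),\qquad w(0)=w_0,$$ has a solution $w(t)\in\mathcal W$ for all $t\in[0,\infty)$; it is unique (any solution on an interval $[0,\tau)$, $\tau>0$, agrees with it there); and it converges exponentially fast to $\bar w$: there are constants $C,c>0$ (which may depend on all the data) with $\|w(t)-\bar w\|\le Ce^{-ct}$ for all $t\ge0$. -/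

import Mathlib

open scoped Matrix

/-! ### Right-angled hexagons in the hyperbolic plane (hyperboloid model) -/

/-- The Minkowski form of signature `(2,1)` on `ℝ³`. -/
def mink (x y : Fin 3 → ℝ) : ℝ := x 0 * y 0 + x 1 * y 1 - x 2 * y 2

/-- The hyperbolic plane: the upper sheet of the hyperboloid. -/
def hyperbolicPlane : Set (Fin 3 → ℝ) := {x | mink x x = -1 ∧ 0 < x 2}

/-- The hyperbolic distance of two points of the hyperbolic plane. -/
noncomputable def hypDist (x y : Fin 3 → ℝ) : ℝ := Real.arcosh (-mink x y)

/-- A positive multiple of the initial velocity, in the tangent plane at `x`, of the geodesic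
from `x` to `y`. -/
def direction (x y : Fin 3 → ℝ) : Fin 3 → ℝ := y + mink x y • x

/-- `p 0, …, p 5` are the consecutive vertices, in counterclockwise order, of a convex hexagon in
the hyperbolic plane all of whose angles are right angles. Convexity: every vertex off a side
lies strictly to the left of the line through that side. -/
structure IsRightAngledHexagon (p : Fin 6 → Fin 3 → ℝ) : Prop where
  mem : ∀ k, p k ∈ hyperbolicPlane
  convex : ∀ k m, m ≠ k → m ≠ k + 1 → 0 < (Matrix.of ![p k, p (k + 1), p m]).det
  right_angle : ∀ k,
    mink (direction (p (k + 1)) (p k)) (direction (p (k + 1)) (p (k + 2))) = 0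

/-- `p` is a right-angled hexagon whose red sides (pairwise non-adjacent) are
`p 3 p 4`, `p 5 p 0`, `p 1 p 2`, of lengths `x`, `y`, `z`. Its black sides are `p 0 p 1`
(opposite to the red side of length `x`), `p 2 p 3` and `p 4 p 5`. -/
structure IsHexagonWithRedLengths (x y z : ℝ) (p : Fin 6 → Fin 3 → ℝ) : Prop
    extends IsRightAngledHexagon p where
  length_opposite : hypDist (p 3) (p 4) = x
  length_left : hypDist (p 5) (p 0) = y
  length_right : hypDist (p 1) (p 2) = z

open Classical in
/-- The length of the black side which is opposite to the red side of length `x`, in the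
right-angled hyperbolic hexagon with red side lengths `x`, `y`, `z`
(which exists and is unique up to isometry if these are positive). -/
noncomputable def arcLength (x y z : ℝ) : ℝ :=
  if h : ∃ p, IsHexagonWithRedLengths x y z p then hypDist (h.choose 0) (h.choose 1) else 0

theorem mink_le_neg_one {x y : Fin 3 → ℝ} (hx : x ∈ hyperbolicPlane)
    (hy : y ∈ hyperbolicPlane) : mink x y ≤ -1 := by
  obtain ⟨hx1, hx2⟩ := hx
  obtain ⟨hy1, hy2⟩ := hy
  simp only [mink] at *
  have h : x 0 * y 0 + x 1 * y 1 + 1 ≤ x 2 * y 2 := by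
    refine abs_le_of_sq_le_sq' ?_ (by positivity) |>.2
    have e : (x 2 * y 2) ^ 2 = (x 2 * x 2) * (y 2 * y 2) := by ring
    have e1 : x 2 * x 2 = 1 + x 0 * x 0 + x 1 * x 1 := by linarith
    have e2 : y 2 * y 2 = 1 + y 0 * y 0 + y 1 * y 1 := by linarith
    rw [e, e1, e2]
    nlinarith [sq_nonneg (x 0 - y 0), sq_nonneg (x 1 - y 1), sq_nonneg (x 0 * y 1 - x 1 * y 0)]
  linarith

theorem cosh_hypDist {x y : Fin 3 → ℝ} (hx : x ∈ hyperbolicPlane)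
    (hy : y ∈ hyperbolicPlane) : Real.cosh (hypDist x y) = -mink x y :=
  Real.cosh_arcosh (by linarith [mink_le_neg_one hx hy])

theorem det_of_rows (a b c : Fin 3 → ℝ) : (Matrix.of ![a, b, c]).det =
    a 0 * (b 1 * c 2 - b 2 * c 1) + a 1 * (b 2 * c 0 - b 0 * c 2)
      + a 2 * (b 0 * c 1 - b 1 * c 0) := by
  simp [Matrix.det_fin_three]
  ring

/-- Two vectors orthogonal to the same hyperbolic line and pointing to the same side of it
are parallel. -/
theorem smul_eq_smul_of_orthogonal {p q u v : Fin 3 → ℝ} {a b : ℝ} (ha : 0 < a) (hb : 0 < b)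
    (hpu : mink p u = 0) (hqu : mink q u = 0) (hpv : mink p v = 0) (hqv : mink q v = 0)
    (hu : mink u u = a ^ 2) (hv : mink v v = b ^ 2)
    (hdu : 0 < (Matrix.of ![p, q, u]).det) (hdv : 0 < (Matrix.of ![p, q, v]).det) :
    b • u = a • v := by
  set g : ℝ := mink p q ^ 2 - mink p p * mink q q with hg
  have key : ∀ w : Fin 3 → ℝ, mink p w = 0 → mink q w = 0 →
      (Matrix.of ![p, q, w]).det ^ 2 = g * mink w w ∧
      g * w 0 = (Matrix.of ![p, q, w]).det * (p 1 * q 2 - p 2 * q 1) ∧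
      g * w 1 = (Matrix.of ![p, q, w]).det * (p 2 * q 0 - p 0 * q 2) ∧
      g * w 2 = (Matrix.of ![p, q, w]).det * (p 1 * q 0 - p 0 * q 1) := by
    intro w h1 h2
    have id : (Matrix.of ![p, q, w]).det ^ 2 = g * mink w w
        - (mink p q * mink q w - mink q q * mink p w) * mink p w
        - (mink p q * mink p w - mink p p * mink q w) * mink q w := by
      rw [det_of_rows, hg]; simp only [mink]; ring
    have id0 : g * w 0 = (Matrix.of ![p, q, w]).det * (p 1 * q 2 - p 2 * q 1)
        + (mink p q * mink q w - mink q q * mink p w) * p 0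
        + (mink p q * mink p w - mink p p * mink q w) * q 0 := by
      rw [det_of_rows, hg]; simp only [mink]; ring
    have id1 : g * w 1 = (Matrix.of ![p, q, w]).det * (p 2 * q 0 - p 0 * q 2)
        + (mink p q * mink q w - mink q q * mink p w) * p 1
        + (mink p q * mink p w - mink p p * mink q w) * q 1 := by
      rw [det_of_rows, hg]; simp only [mink]; ring
    have id2 : g * w 2 = (Matrix.of ![p, q, w]).det * (p 1 * q 0 - p 0 * q 1)
        + (mink p q * mink q w - mink q q * mink p w) * p 2
        + (mink p q * mink p w - mink p p * mink q w) * q 2 := by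
      rw [det_of_rows, hg]; simp only [mink]; ring
    rw [h1, h2] at id id0 id1 id2
    exact ⟨by linarith, by linarith, by linarith, by linarith⟩
  obtain ⟨u', u0, u1, u2⟩ := key u hpu hqu
  obtain ⟨v', v0, v1, v2⟩ := key v hpv hqv
  rw [hu] at u'
  rw [hv] at v'
  generalize (Matrix.of ![p, q, u]).det = d at *
  generalize (Matrix.of ![p, q, v]).det = e at *
  have hgpos : 0 < g := by
    have : 0 < g * a ^ 2 := u' ▸ by positivity
    exact pos_of_mul_pos_left this (by positivity)
  have hde : b * d = a * e := by
    have h : (b * d) ^ 2 = (a * e) ^ 2 := by rw [mul_pow, mul_pow, u', v']; ring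
    exact (pow_left_inj₀ (by positivity) (by positivity) two_ne_zero).1 h
  funext i
  simp only [Pi.smul_apply, smul_eq_mul]
  apply mul_left_cancel₀ hgpos.ne'
  fin_cases i <;> simp only [Fin.zero_eta, Fin.mk_one, Fin.reduceFinMk]
  · linear_combination b * u0 - a * v0 + (p 1 * q 2 - p 2 * q 1) * hde
  · linear_combination b * u1 - a * v1 + (p 2 * q 0 - p 0 * q 2) * hde
  · linear_combination b * u2 - a * v2 + (p 1 * q 0 - p 0 * q 1) * hde

theorem mink_comm (x y : Fin 3 → ℝ) : mink x y = mink y x := by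
  simp only [mink]; ring

theorem mink_add_smul_right (a b c : Fin 3 → ℝ) (r : ℝ) :
    mink a (b + r • c) = mink a b + r * mink a c := by
  simp only [mink, Pi.add_apply, Pi.smul_apply, smul_eq_mul]; ring

theorem mink_add_smul_left (a b c : Fin 3 → ℝ) (r : ℝ) :
    mink (b + r • c) a = mink b a + r * mink c a := by
  simp only [mink, Pi.add_apply, Pi.smul_apply, smul_eq_mul]; ring

theorem mink_smul_smul (a b : Fin 3 → ℝ) (r t : ℝ) :
    mink (r • a) (t • b) = r * t * mink a b := by
  simp only [mink, Pi.smul_apply, smul_eq_mul]; ring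

theorem det_add_smul_left (p q u : Fin 3 → ℝ) (r : ℝ) :
    (Matrix.of ![p, q, u + r • p]).det = (Matrix.of ![p, q, u]).det := by
  simp only [det_of_rows, Pi.add_apply, Pi.smul_apply, smul_eq_mul]; ring

theorem det_add_smul_right (p q u : Fin 3 → ℝ) (r : ℝ) :
    (Matrix.of ![p, q, u + r • q]).det = (Matrix.of ![p, q, u]).det := by
  simp only [det_of_rows, Pi.add_apply, Pi.smul_apply, smul_eq_mul]; ring

/-- The cosine law for right-angled hexagons. -/
theorem IsHexagonWithRedLengths.cosine_law {x y z : ℝ} {p : Fin 6 → Fin 3 → ℝ}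
    (hx : 0 < x) (hy : 0 < y) (hz : 0 < z) (h : IsHexagonWithRedLengths x y z p) :
    Real.cosh (hypDist (p 0) (p 1)) =
      (Real.cosh y * Real.cosh z + Real.cosh x) / (Real.sinh y * Real.sinh z) := by
  have H := h.mem
  have n := fun k => (H k).1
  have e34 : mink (p 3) (p 4) = -Real.cosh x := by
    rw [← h.length_opposite, cosh_hypDist (H 3) (H 4), neg_neg]
  have e50 : mink (p 5) (p 0) = -Real.cosh y := by
    rw [← h.length_left, cosh_hypDist (H 5) (H 0), neg_neg]
  have e12 : mink (p 1) (p 2) = -Real.cosh z := by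
    rw [← h.length_right, cosh_hypDist (H 1) (H 2), neg_neg]
  have e43 := (mink_comm (p 4) (p 3)).trans e34
  have e05 := (mink_comm (p 0) (p 5)).trans e50
  have e21 := (mink_comm (p 2) (p 1)).trans e12
  rw [cosh_hypDist (H 0) (H 1)]
  have sx := Real.sinh_pos_iff.2 hx
  have sy := Real.sinh_pos_iff.2 hy
  have sz := Real.sinh_pos_iff.2 hz
  have csx := Real.cosh_sq x
  have csy := Real.cosh_sq y
  have csz := Real.cosh_sq z
  generalize Real.cosh x = X at *
  generalize Real.cosh y = Y at *
  generalize Real.cosh z = Z at *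
  generalize Real.sinh x = a at *
  generalize Real.sinh y = b at *
  generalize Real.sinh z = c at *
  have r : ∀ k, mink (p k) (p (k + 2)) =
      -(mink (p k) (p (k + 1)) * mink (p (k + 1)) (p (k + 2))) := by
    intro k
    have e := h.right_angle k
    simp only [direction, mink_add_smul_left, mink_add_smul_right, n,
      mink_comm (p (k + 1)) (p k)] at e
    linarith
  have r0 := r 0
  have r1 := r 1
  have r2 := r 2
  have r3 := r 3
  have r4 := r 4
  have r5 := r 5
  have d0 := fun m => h.convex 0 m
  have d2 := fun m => h.convex 2 m
  have d4 := fun m => h.convex 4 m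
  simp only [Fin.reduceAdd, zero_add, e34, e50, e12] at r0 r1 r2 r3 r4 r5 d0 d2 d4
  have A := smul_eq_smul_of_orthogonal (p := p 2) (q := p 3)
    (u := p 1 + (-Z) • p 2) (v := p 4 + (-X) • p 3) sz sx
    (by rw [mink_add_smul_right, n, e21]; ring)
    (by rw [mink_add_smul_right, mink_comm, r1, mink_comm (p 3) (p 2)]; ring)
    (by rw [mink_add_smul_right, r2]; ring)
    (by rw [mink_add_smul_right, n, e34]; ring)
    (by simp only [mink_add_smul_right, mink_add_smul_left, n, e12, e21]
        linear_combination csz)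
    (by simp only [mink_add_smul_right, mink_add_smul_left, n, e34, e43]
        linear_combination csx)
    (by rw [det_add_smul_left]; exact d2 1 (by decide) (by decide))
    (by rw [det_add_smul_right]; exact d2 4 (by decide) (by decide))
  have B := smul_eq_smul_of_orthogonal (p := p 4) (q := p 5)
    (u := p 0 + (-Y) • p 5) (v := p 3 + (-X) • p 4) sy sx
    (by rw [mink_add_smul_right, r4]; ring)
    (by rw [mink_add_smul_right, n, e50]; ring)
    (by rw [mink_add_smul_right, n, e43]; ring)
    (by rw [mink_add_smul_right, mink_comm, r3, mink_comm (p 5) (p 4)]; ring)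
    (by simp only [mink_add_smul_right, mink_add_smul_left, n, e50, e05]
        linear_combination csy)
    (by simp only [mink_add_smul_right, mink_add_smul_left, n, e34, e43]
        linear_combination csx)
    (by rw [det_add_smul_right]; exact d4 0 (by decide) (by decide))
    (by rw [det_add_smul_left]; exact d4 3 (by decide) (by decide))
  have C := smul_eq_smul_of_orthogonal (p := p 0) (q := p 1)
    (u := p 2 + (-Z) • p 1) (v := p 5 + (-Y) • p 0) sz sy
    (by rw [mink_add_smul_right, r0]; ring)
    (by rw [mink_add_smul_right, n, e12]; ring)
    (by rw [mink_add_smul_right, n, e05]; ring)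
    (by rw [mink_add_smul_right, mink_comm, r5, mink_comm (p 1) (p 0)]; ring)
    (by simp only [mink_add_smul_right, mink_add_smul_left, n, e12, e21]
        linear_combination csz)
    (by simp only [mink_add_smul_right, mink_add_smul_left, n, e50, e05]
        linear_combination csy)
    (by rw [det_add_smul_right]; exact d0 2 (by decide) (by decide))
    (by rw [det_add_smul_left]; exact d0 5 (by decide) (by decide))
  have AB := congrArg₂ mink A B
  have CC := congrArg₂ mink C (rfl : b • (p 5 + (-Y) • p 0) = b • (p 5 + (-Y) • p 0))
  simp only [mink_smul_smul, mink_add_smul_right, mink_add_smul_left, n, e34, e43,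
    e50, e05, r0, r5, mink_comm (p 1) (p 5), mink_comm (p 2) (p 0),
    mink_comm (p 1) (p 0)] at AB CC
  generalize mink (p 0) (p 1) = t at *
  generalize mink (p 2) (p 5) = w at *
  rw [eq_div_iff (by positivity)]
  have hw : w = Y * Z * t + b * c := by
    apply mul_left_cancel₀ (show b * b ≠ 0 by positivity)
    linear_combination CC + c * b * csy
  subst hw
  apply mul_left_cancel₀ (show a * a * (b * c) ≠ 0 by positivity)
  linear_combination -AB + (a * a * t * (Y ^ 2 - 1)) * csz + (a * a * t * c ^ 2) * csy
    + c * b * X * csx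

/-- For any three positive numbers there is a right-angled hexagon with these red lengths. -/
theorem exists_isHexagonWithRedLengths {x y z : ℝ} (hx : 0 < x) (hy : 0 < y) (hz : 0 < z) :
    ∃ p, IsHexagonWithRedLengths x y z p := by
  have sx := Real.sinh_pos_iff.2 hx
  have sy := Real.sinh_pos_iff.2 hy
  have sz := Real.sinh_pos_iff.2 hz
  have cx := Real.cosh_pos x
  have cy := Real.cosh_pos y
  have cz := Real.cosh_pos z
  have csx := Real.cosh_sq x
  have csy := Real.cosh_sq y
  have csz := Real.cosh_sq z
  have ax := Real.arcosh_cosh hx.le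
  have ay := Real.arcosh_cosh hy.le
  have az := Real.arcosh_cosh hz.le
  generalize Real.cosh x = X at *
  generalize Real.cosh y = Y at *
  generalize Real.cosh z = Z at *
  generalize Real.sinh x = a at *
  generalize Real.sinh y = b at *
  generalize Real.sinh z = c at *
  obtain ⟨C, hC⟩ : ∃ C, C * (b * c) = Y * Z + X := ⟨(Y * Z + X) / (b * c), by field_simp⟩
  have hC1 : 1 < C := by
    have h1 : b * c < Y * Z := by
      have : b < Y := by nlinarith
      have : c < Z := by nlinarith
      gcongr
    by_contra h
    have : C * (b * c) ≤ 1 * (b * c) := by gcongr; exact not_lt.1 h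
    linarith
  obtain ⟨S, hS, hSC⟩ : ∃ S, 0 < S ∧ S ^ 2 = C ^ 2 - 1 :=
    ⟨√(C ^ 2 - 1), Real.sqrt_pos.2 (by nlinarith), Real.sq_sqrt (by nlinarith)⟩
  set p : Fin 6 → Fin 3 → ℝ := ![![0, 0, 1], ![S, 0, C], ![Z * S, c, Z * C],
    ![X * c * S / a, (Y + X * Z) / a, (b + X * c * C) / a],
    ![c * S / a, (Z + X * Y) / a, (c * C + X * b) / a], ![0, b, Y]] with hp
  have n : ∀ k, mink (p k) (p k) = -1 := by
    intro k
    fin_cases k <;> simp [hp, mink] <;> grind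
  have m01 : mink (p 0) (p 1) = -C := by simp [hp, mink]
  have m12 : mink (p 1) (p 2) = -Z := by simp [hp, mink]; grind
  have m34 : mink (p 3) (p 4) = -X := by simp [hp, mink]; grind
  have m50 : mink (p 5) (p 0) = -Y := by simp [hp, mink]
  have r : ∀ k, mink (p k) (p (k + 2)) + mink (p (k + 1)) (p k) * mink (p (k + 1)) (p (k + 2)) = 0 := by
    intro k
    fin_cases k <;> simp [hp, mink] <;> grind
  refine ⟨p, ⟨⟨?_, ?_, ?_⟩, ?_, ?_, ?_⟩⟩
  · intro k
    refine ⟨n k, ?_⟩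
    fin_cases k <;> simp [hp] <;> positivity
  · intro k m h1 h2
    obtain ⟨e, he⟩ : ∃ e : Fin 6 → Fin 6 → ℝ, e = ![
      ![1, 1, S * c, S * (Y + X * Z) / a, S * (X * Y + Z) / a, S * b],
      ![S * c, 1, 1, S * b * c / a, S * b * X * c / a, S * Y * c],
      ![S * (X + Y * Z) / a, S * b * c / a, 1, 1, S * b, S * (X * Y + Z) / a],
      ![S * c * Y, S * b * Z, S * b, 1, 1, S * c],
      ![S * c * b / a, S * (Y * Z + X) / a, S * (Y + X * Z) / a, S * c, 1, 1],
      ![1, S * b, S * Z * b, S * c * X * b / a, S * c * b / a, 1]] := ⟨_, rfl⟩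
    have e_pos : 0 < e k m := by
      rw [he]; fin_cases k <;> fin_cases m <;> simp <;> positivity
    have e_eq : (Matrix.of ![p k, p (k + 1), p m]).det = e k m := by
      rw [det_of_rows, he]
      clear n r m01 m12 m34 m50 hC1 ax ay az hx hy hz e_pos he e
      fin_cases k <;> fin_cases m <;> first | exact absurd rfl h1 | exact absurd rfl h2 | skip
      all_goals
        clear h1 h2
        simp [hp] <;> (try field_simp) <;> grind
    rw [e_eq]
    exact e_pos
  · intro k
    simp only [direction, mink_add_smul_left, mink_add_smul_right, n]
    rw [mink_comm (p k) (p (k + 1))]; linear_combination r k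
  · rw [hypDist, m34, neg_neg, ax]
  · rw [hypDist, m50, neg_neg, ay]
  · rw [hypDist, m12, neg_neg, az]

theorem IsHexagonWithRedLengths.hypDist_eq_arcLength {x y z : ℝ} {p : Fin 6 → Fin 3 → ℝ}
    (hx : 0 < x) (hy : 0 < y) (hz : 0 < z) (h : IsHexagonWithRedLengths x y z p) :
    hypDist (p 0) (p 1) = arcLength x y z := by
  have h' : ∃ p, IsHexagonWithRedLengths x y z p := ⟨p, h⟩
  rw [arcLength, dif_pos h']
  have h0 : ∀ q, IsHexagonWithRedLengths x y z q → 0 ≤ hypDist (q 0) (q 1) := fun q hq =>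
    Real.arcosh_nonneg (by linarith [mink_le_neg_one (hq.mem 0) (hq.mem 1)])
  refine Real.cosh_injOn (h0 _ h) (h0 _ h'.choose_spec) ?_
  rw [h.cosine_law hx hy hz, h'.choose_spec.cosine_law hx hy hz]

theorem arcLength_eq {x y z : ℝ} (hx : 0 < x) (hy : 0 < y) (hz : 0 < z) :
    arcLength x y z = Real.arcosh
      ((Real.cosh y * Real.cosh z + Real.cosh x) / (Real.sinh y * Real.sinh z)) := by
  obtain ⟨p, h⟩ := exists_isHexagonWithRedLengths hx hy hz
  rw [← h.cosine_law hx hy hz, ← h.hypDist_eq_arcLength hx hy hz, Real.arcosh_cosh]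
  exact Real.arcosh_nonneg (by linarith [mink_le_neg_one (h.mem 0) (h.mem 1)])

/-! ### Ideally triangulated surfaces with boundary -/

/-- An ideally triangulated compact surface with boundary, as the gluing pattern of a finite set
`F` of hexagons. The black sides (corners) of the hexagon `f` are `(f, 0)`, `(f, 1)`, `(f, 2)`
in cyclic order, and its red sides are also indexed by `Fin 3`: the red side `(f, a)` is opposite
to the corner `(f, a)` and joins the corners `(f, a + 1)` and `(f, a + 2)`. The red sides are
identified in pairs by `glue`. The identification of a red side with its partner is by an
orientation-compatible homeomorphism if the side is not `twisted` and by an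
orientation-reversing one if it is, so that nonorientable surfaces are allowed. -/
structure IdealTriangulation (F : Type*) where
  glue : F × Fin 3 → F × Fin 3
  glue_glue : ∀ e, glue (glue e) = e
  glue_ne : ∀ e, glue e ≠ e
  twisted : F × Fin 3 → Bool
  twisted_glue : ∀ e, twisted (glue e) = twisted e

namespace IdealTriangulation

/-- The corner at which the red side `e` starts. -/
def firstEnd {F : Type*} (e : F × Fin 3) : F × Fin 3 := (e.1, e.2 + 1)

/-- The corner at which the red side `e` stops. -/
def secondEnd {F : Type*} (e : F × Fin 3) : F × Fin 3 := (e.1, e.2 + 2)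

/-- Two black sides share an endpoint on the surface, because the red sides `e` and `glue e` at
which they end are identified. -/
inductive CornerAdj {F : Type*} (T : IdealTriangulation F) : F × Fin 3 → F × Fin 3 → Prop
  | first_second (e : F × Fin 3) (h : T.twisted e = false) :
      CornerAdj T (firstEnd e) (secondEnd (T.glue e))
  | second_first (e : F × Fin 3) (h : T.twisted e = false) :
      CornerAdj T (secondEnd e) (firstEnd (T.glue e))
  | first_first (e : F × Fin 3) (h : T.twisted e = true) :
      CornerAdj T (firstEnd e) (firstEnd (T.glue e))
  | second_second (e : F × Fin 3) (h : T.twisted e = true) :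
      CornerAdj T (secondEnd e) (secondEnd (T.glue e))

/-- The boundary components: the classes of black sides connected through shared endpoints. -/
def Boundary {F : Type*} (T : IdealTriangulation F) : Type _ := Quot T.CornerAdj

/-- The edges: the classes of red sides under the identification in pairs. -/
def Edge {F : Type*} (T : IdealTriangulation F) : Type _ := Quot fun e e' => T.glue e = e'

/-- The boundary component that contains a black side. -/
def component {F : Type*} (T : IdealTriangulation F) (c : F × Fin 3) : T.Boundary :=
  Quot.mk _ c

/-- The edge that is the image of a red side. -/
def edge {F : Type*} (T : IdealTriangulation F) (e : F × Fin 3) : T.Edge := Quot.mk _ e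

instance {F : Type*} [Finite F] (T : IdealTriangulation F) : Finite T.Boundary :=
  Finite.of_surjective T.component Quot.mk_surjective

noncomputable instance {F : Type*} [Fintype F] (T : IdealTriangulation F) :
    Fintype T.Boundary := Fintype.ofFinite _

noncomputable instance {F : Type*} (T : IdealTriangulation F) : DecidableEq T.Boundary :=
  Classical.decEq _

/-- `w_i + w_j` for the edge `ij`, where `i` and `j` are the boundary components (possibly equal)
at its two ends. -/
def endSum {F : Type*} (T : IdealTriangulation F) (w : T.Boundary → ℝ) : T.Edge → ℝ :=
  Quot.lift (fun e => w (T.component (firstEnd e)) + w (T.component (secondEnd e))) (by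
    rintro e _ rfl
    cases h : T.twisted e
    · have h1 : T.component (firstEnd e) = T.component (secondEnd (T.glue e)) :=
        Quot.sound (.first_second e h)
      have h2 : T.component (secondEnd e) = T.component (firstEnd (T.glue e)) :=
        Quot.sound (.second_first e h)
      simp only [h1, h2, add_comm]
    · have h1 : T.component (firstEnd e) = T.component (firstEnd (T.glue e)) :=
        Quot.sound (.first_first e h)
      have h2 : T.component (secondEnd e) = T.component (secondEnd (T.glue e)) :=
        Quot.sound (.second_second e h)
      simp only [h1, h2])

open Classical in
/-- The generalized combinatorial curvature of a discrete hyperbolic metric `l`: the length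
of the boundary component `i`, which is the sum of the lengths of its black sides in the
right-angled hyperbolic hexagons with red side lengths given by `l`. -/
noncomputable def curvature {F : Type*} [Fintype F] (T : IdealTriangulation F)
    (l : T.Edge → ℝ) (i : T.Boundary) : ℝ :=
  ∑ c : F × Fin 3 with T.component c = i,
    arcLength (l (T.edge c)) (l (T.edge (c.1, c.2 + 1))) (l (T.edge (c.1, c.2 + 2)))

/-! ### Vertex scaling -/

/-- `l` is obtained from `lt` by vertex scaling with the conformal factor `w`. -/
def IsVertexScaling {F : Type*} (T : IdealTriangulation F) (lt : T.Edge → ℝ)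
    (w : T.Boundary → ℝ) (l : T.Edge → ℝ) : Prop :=
  ∀ e, Real.cosh (l e / 2) = Real.exp (T.endSum w e) * Real.cosh (lt e / 2)

/-- The space of admissible discrete conformal factors of `lt`. -/
def admissible {F : Type*} (T : IdealTriangulation F) (lt : T.Edge → ℝ) :
    Set (T.Boundary → ℝ) :=
  {w | ∃ l : T.Edge → ℝ, (∀ e, 0 < l e) ∧ T.IsVertexScaling lt w l}

/-- The metric `w * lt`. -/
noncomputable def scale {F : Type*} (T : IdealTriangulation F) (lt : T.Edge → ℝ)
    (w : T.Boundary → ℝ) (e : T.Edge) : ℝ :=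
  2 * Real.arcosh (Real.exp (T.endSum w e) * Real.cosh (lt e / 2))

theorem isVertexScaling_iff_eq_scale {F : Type*} {T : IdealTriangulation F} {lt : T.Edge → ℝ}
    {w : T.Boundary → ℝ} (hw : w ∈ T.admissible lt) {l : T.Edge → ℝ} :
    ((∀ e, 0 < l e) ∧ T.IsVertexScaling lt w l) ↔ l = T.scale lt w := by
  have key : ∀ l : T.Edge → ℝ, ((∀ e, 0 < l e) ∧ T.IsVertexScaling lt w l) →
      l = T.scale lt w := by
    rintro l ⟨h1, h2⟩
    funext e
    have := h1 e
    rw [scale, ← h2 e, Real.arcosh_cosh (by linarith)]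
    ring
  refine ⟨key l, ?_⟩
  rintro rfl
  obtain ⟨l, hl⟩ := hw
  exact key l hl ▸ hl

/-- The generalized combinatorial curvature `K` of the metric `w * lt`, as a function of `w`. -/
noncomputable def K {F : Type*} [Fintype F] (T : IdealTriangulation F) (lt : T.Edge → ℝ)
    (w : T.Boundary → ℝ) : T.Boundary → ℝ :=
  T.curvature (T.scale lt w)

/-- The discrete Laplace operator: the Jacobian matrix `(∂K_i/∂w_j)`. -/
noncomputable def laplacian {F : Type*} [Fintype F] (T : IdealTriangulation F)
    (lt : T.Edge → ℝ) (w : T.Boundary → ℝ) : Matrix T.Boundary T.Boundary ℝ :=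
  Matrix.of fun i j => fderiv ℝ (T.K lt) w (Pi.single j 1) i

end IdealTriangulation

/-! ### The fractional combinatorial Calabi flow -/

/-- The real power `A ^ s` of a symmetric positive definite matrix, by the functional calculus
(see `matrixRpow_eq` for the description by an orthogonal diagonalization). -/
noncomputable def matrixRpow {ι : Type*} [Fintype ι] [DecidableEq ι] (A : Matrix ι ι ℝ)
    (s : ℝ) : Matrix ι ι ℝ :=
  cfc (fun x : ℝ => x ^ s) A

theorem matrixRpow_eq {ι : Type*} [Fintype ι] [DecidableEq ι] {A P : Matrix ι ι ℝ} {d : ι → ℝ}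
    (hP : P ∈ Matrix.orthogonalGroup ι ℝ) (hA : A = Pᵀ * Matrix.diagonal d * P) (s : ℝ) :
    matrixRpow A s = Pᵀ * Matrix.diagonal (fun i => d i ^ s) * P := by
  have hP1 : P * Pᵀ = 1 := (Matrix.mem_orthogonalGroup_iff ι ℝ).1 hP
  have hsa : IsSelfAdjoint A := by
    rw [hA]
    simp [IsSelfAdjoint, Matrix.star_eq_conjTranspose, Matrix.mul_assoc,
      Matrix.conjTranspose_eq_transpose_of_trivial]
  have haeval : ∀ q : Polynomial ℝ, Polynomial.aeval A q =
      Pᵀ * Matrix.diagonal (fun i => q.eval (d i)) * P := by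
    have hP2 : Pᵀ * P = 1 := (Matrix.mem_orthogonalGroup_iff' ι ℝ).1 hP
    intro q
    induction q using Polynomial.induction_on with
    | C r =>
      have : Matrix.diagonal (fun _ : ι => r) = r • (1 : Matrix ι ι ℝ) := by
        rw [← Matrix.diagonal_one, ← Matrix.diagonal_smul]; congr 1; ext; simp
      simp [this, hP2, Algebra.algebraMap_eq_smul_one]
    | add q r hq hr =>
      simp only [map_add, hq, hr, Polynomial.eval_add]
      rw [← add_mul, ← mul_add, Matrix.diagonal_add]
    | monomial k r h =>
      rw [pow_succ, ← mul_assoc, map_mul, h, Polynomial.aeval_X]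
      simp only [Polynomial.eval_mul, Polynomial.eval_X]
      calc _ = Pᵀ * Matrix.diagonal (fun i => (Polynomial.C r * Polynomial.X ^ k).eval (d i))
              * (P * Pᵀ) * Matrix.diagonal d * P := by simp only [hA, mul_assoc, Polynomial.eval_mul]
        _ = _ := by
          rw [hP1, mul_one, mul_assoc Pᵀ, Matrix.diagonal_mul_diagonal]
          simp only [Polynomial.eval_mul, Polynomial.eval_X]
  have hspec : ∀ x ∈ spectrum ℝ A, ∃ i, d i = x := by
    intro x hx
    have h := spectrum.subset_polynomial_aeval A
      (∏ i, (Polynomial.X - Polynomial.C (d i))) ⟨x, hx, rfl⟩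
    have h0 : ∀ i, (∏ j, (Polynomial.X - Polynomial.C (d j))).eval (d i) = 0 := fun i => by
      rw [Polynomial.eval_prod]
      exact Finset.prod_eq_zero (Finset.mem_univ i) (by simp)
    simp only [haeval, h0, Matrix.diagonal_zero, mul_zero, zero_mul] at h
    have h1 : (∏ j, (Polynomial.X - Polynomial.C (d j))).eval x = 0 := by
      by_contra hne
      rw [spectrum.mem_iff, sub_zero] at h
      exact h ((IsUnit.mk0 _ hne).map (algebraMap ℝ (Matrix ι ι ℝ)))
    rw [Polynomial.eval_prod, Finset.prod_eq_zero_iff] at h1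
    obtain ⟨i, -, hi⟩ := h1
    exact ⟨i, by simpa [sub_eq_zero, eq_comm] using hi⟩
  have hq : ∀ i, (Lagrange.interpolate (Finset.univ.image d) id (fun x : ℝ => x ^ s)).eval (d i)
      = d i ^ s := fun i =>
    Lagrange.eval_interpolate_at_node (v := id) _ Function.injective_id.injOn
      (Finset.mem_image_of_mem d (Finset.mem_univ i))
  have hc : matrixRpow A s =
      cfc (Lagrange.interpolate (Finset.univ.image d) id (fun x : ℝ => x ^ s)).eval A := by
    refine cfc_congr fun x hx => ?_
    obtain ⟨i, rfl⟩ := hspec x hx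
    exact (hq i).symm
  rw [hc, cfc_polynomial _ A hsa, haeval]
  simp only [hq]

namespace IdealTriangulation

/-- The fractional discrete Laplace operator `Δ^s = -(-Δ)^s`. -/
noncomputable def fractionalLaplacian {F : Type*} [Fintype F] (T : IdealTriangulation F)
    (lt : T.Edge → ℝ) (s : ℝ) (w : T.Boundary → ℝ) : Matrix T.Boundary T.Boundary ℝ :=
  -matrixRpow (-T.laplacian lt w) s

/-- The right-hand side `K - K̄` of the combinatorial Yamabe flow. -/
noncomputable def yamabeField {F : Type*} [Fintype F] (T : IdealTriangulation F)
    (lt : T.Edge → ℝ) (Kbar w : T.Boundary → ℝ) : T.Boundary → ℝ :=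
  T.K lt w - Kbar

/-- The right-hand side `Δ(K̄ - K)` of the combinatorial Calabi flow. -/
noncomputable def calabiField {F : Type*} [Fintype F] (T : IdealTriangulation F)
    (lt : T.Edge → ℝ) (Kbar w : T.Boundary → ℝ) : T.Boundary → ℝ :=
  T.laplacian lt w *ᵥ (Kbar - T.K lt w)

/-- The right-hand side `Δ^s(K̄ - K)` of the fractional combinatorial Calabi flow. -/
noncomputable def fractionalCalabiField {F : Type*} [Fintype F] (T : IdealTriangulation F)
    (lt : T.Edge → ℝ) (Kbar : T.Boundary → ℝ) (s : ℝ) (w : T.Boundary → ℝ) : T.Boundary → ℝ :=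
  T.fractionalLaplacian lt s w *ᵥ (Kbar - T.K lt w)

/-- `w` solves the fractional combinatorial Calabi flow `dw/dt = Δ^s(K̄ - K)`, `w(0) = w₀`, on
the time interval `I`, staying in the space of admissible factors (where the flow is defined). -/
structure IsFractionalCalabiFlow {F : Type*} [Fintype F] (T : IdealTriangulation F)
    (lt : T.Edge → ℝ) (Kbar : T.Boundary → ℝ) (s : ℝ) (w₀ : T.Boundary → ℝ) (I : Set ℝ)
    (w : ℝ → T.Boundary → ℝ) : Prop where
  init : w 0 = w₀
  mem : ∀ t ∈ I, w t ∈ T.admissible lt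
  deriv : ∀ t ∈ I, HasDerivWithinAt w (T.fractionalCalabiField lt Kbar s (w t)) I t

end IdealTriangulation

/-! ### Powers of positive definite matrices -/

/-! The geometry enters through `IsCurvatureMap` alone: a positive C² map `K` on an open convex
domain `W`, with symmetric positive definite `-∂K/∂w` and two properness properties. The rest is
analysis of such maps.

Definiteness is local. By the derivative cosine law, the variation of the black sides of one hexagon
under vertex scaling is a negative multiple of `cornerVariation`, and the resulting form
`hexagonForm` is symmetric and an explicit sum of squares. Summing over hexagons gives the form of
`-Δ`. Properness comes from three estimates: a short red side forces long black sides next to it, so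
an upper bound on `K` keeps `w` away from the boundary of `W`; a very negative `w i` forces long
black sides; a large `w i`, with the other factors bounded below, forces short ones. So `K` in a
compact box of positive vectors confines `w` to a compact subset of `W`.

Definiteness makes `-K` strictly monotone, hence `K` injective. For surjectivity, `∑ (log K i - log
K̄ i)²` attains its minimum by properness, and a critical point must be a zero because the Jacobian
is definite.

The flow is `dw/dt = (-Δ)^s (K - K̄)` and has two Lyapunov functions. The energy `|K - K̄|²`
decreases because `(-Δ)^(1+s)` is positive; the convex potential with gradient `K̄ - K` decreases
because `(-Δ)^s` is. The energy bounds `K` from above but does not keep it away from `0`; the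
potential supplies the missing bound on `w`. Together they give a compact invariant set. There the
field is Lipschitz, since `A ↦ A^s` is Lipschitz on symmetric matrices with spectrum in a compact
part of `(0, ∞)`, so solutions are global and unique. The eigenvalues of `(-Δ)^(1+s)` are bounded
below on this set, so the energy decays exponentially, and `|w - w̄|` is controlled by `|K - K̄|`.
-/

theorem exists_orthogonal_diagonal {ι : Type*} [Fintype ι] [DecidableEq ι] {A : Matrix ι ι ℝ}
    (hA : A.IsHermitian) : ∃ P ∈ Matrix.orthogonalGroup ι ℝ, ∃ d : ι → ℝ,
      A = Pᵀ * Matrix.diagonal d * P := by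
  refine ⟨star (hA.eigenvectorUnitary : Matrix ι ι ℝ), ?_, hA.eigenvalues, ?_⟩
  · exact (star hA.eigenvectorUnitary).2
  · have h := hA.spectral_theorem
    rw [Unitary.conjStarAlgAut_apply] at h
    simpa [Matrix.star_eq_conjTranspose, Matrix.conjTranspose_eq_transpose_of_trivial,
      Function.comp_def] using h

theorem dotProduct_conj_diagonal_mulVec {ι : Type*} [Fintype ι] [DecidableEq ι]
    (P : Matrix ι ι ℝ) (d x : ι → ℝ) :
    x ⬝ᵥ (Pᵀ * Matrix.diagonal d * P) *ᵥ x = ∑ i, d i * (P *ᵥ x) i ^ 2 := by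
  rw [← Matrix.mulVec_mulVec, ← Matrix.mulVec_mulVec, Matrix.dotProduct_mulVec,
    Matrix.vecMul_transpose, dotProduct]
  refine Finset.sum_congr rfl fun i _ => ?_
  rw [Matrix.mulVec_diagonal]
  ring

theorem sum_sq_orthogonal_mulVec {ι : Type*} [Fintype ι] [DecidableEq ι]
    {P : Matrix ι ι ℝ} (hP : P ∈ Matrix.orthogonalGroup ι ℝ) (x : ι → ℝ) :
    ∑ i, (P *ᵥ x) i ^ 2 = x ⬝ᵥ x := by
  have h := dotProduct_conj_diagonal_mulVec P (fun _ => 1) x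
  have hP2 : Pᵀ * P = 1 := (Matrix.mem_orthogonalGroup_iff' ι ℝ).1 hP
  rw [Matrix.diagonal_one, mul_one, hP2, Matrix.one_mulVec] at h
  simpa using h.symm

theorem exists_orthogonal_diagonal_mem_Icc {ι : Type*} [Fintype ι] [DecidableEq ι]
    {A : Matrix ι ι ℝ} {m M : ℝ} (hA : A.IsHermitian)
    (hm : ∀ x, m * (x ⬝ᵥ x) ≤ x ⬝ᵥ A *ᵥ x) (hM : ∀ x, x ⬝ᵥ A *ᵥ x ≤ M * (x ⬝ᵥ x)) :
    ∃ P ∈ Matrix.orthogonalGroup ι ℝ, ∃ d : ι → ℝ,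
      A = Pᵀ * Matrix.diagonal d * P ∧ ∀ i, d i ∈ Set.Icc m M := by
  obtain ⟨P, hP, d, h⟩ := exists_orthogonal_diagonal hA
  refine ⟨P, hP, d, h, fun i => ?_⟩
  have hP1 : P * Pᵀ = 1 := (Matrix.mem_orthogonalGroup_iff ι ℝ).1 hP
  -- `Pᵀ eᵢ` is a unit eigenvector for `d i`, so the two form bounds at this vector become bounds on
  -- `d i`.
  have e1 : P *ᵥ (Pᵀ *ᵥ Pi.single i 1) = Pi.single i 1 := by
    rw [Matrix.mulVec_mulVec, hP1, Matrix.one_mulVec]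
  have h1 := hm (Pᵀ *ᵥ Pi.single i 1)
  have h2 := hM (Pᵀ *ᵥ Pi.single i 1)
  rw [h, dotProduct_conj_diagonal_mulVec, ← sum_sq_orthogonal_mulVec hP, e1] at h1 h2
  simp only [Pi.single_apply, ite_pow, one_pow, ne_eq, OfNat.ofNat_ne_zero, not_false_eq_true,
    zero_pow, mul_ite, mul_one, mul_zero, Finset.sum_ite_eq', Finset.mem_univ, if_true] at h1 h2
  exact ⟨h1, h2⟩

/-- The minimum covers both signs of the exponent: the power is increasing for `s ≥ 0` and
decreasing for `s ≤ 0`. -/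
theorem Real.min_rpow_le_rpow {m M x : ℝ} (hm : 0 < m) (hx : x ∈ Set.Icc m M) (s : ℝ) :
    min (m ^ s) (M ^ s) ≤ x ^ s := by
  rcases le_total 0 s with hs | hs
  · exact (min_le_left _ _).trans (Real.rpow_le_rpow hm.le hx.1 hs)
  · exact (min_le_right _ _).trans (Real.rpow_le_rpow_of_nonpos (hm.trans_le hx.1) hx.2 hs)

theorem le_dotProduct_matrixRpow_mulVec {ι : Type*} [Fintype ι] [DecidableEq ι]
    {A : Matrix ι ι ℝ} {m M : ℝ} (hA : A.IsHermitian) (hm0 : 0 < m)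
    (hm : ∀ x, m * (x ⬝ᵥ x) ≤ x ⬝ᵥ A *ᵥ x) (hM : ∀ x, x ⬝ᵥ A *ᵥ x ≤ M * (x ⬝ᵥ x))
    (s : ℝ) (x : ι → ℝ) :
    min (m ^ s) (M ^ s) * (x ⬝ᵥ x) ≤ x ⬝ᵥ matrixRpow A s *ᵥ x := by
  obtain ⟨P, hP, d, h, hd⟩ := exists_orthogonal_diagonal_mem_Icc hA hm hM
  rw [matrixRpow_eq hP h, dotProduct_conj_diagonal_mulVec, ← sum_sq_orthogonal_mulVec hP,
    Finset.mul_sum]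
  gcongr with i
  exact Real.min_rpow_le_rpow hm0 (hd i) s

/-- `A` and `A^s` share an eigenbasis, so the product is diagonalized with entries `d i * d i ^ s`.
This product governs the decay of the energy along the flow. -/
theorem le_dotProduct_mul_matrixRpow_mulVec {ι : Type*} [Fintype ι] [DecidableEq ι]
    {A : Matrix ι ι ℝ} {m M : ℝ} (hA : A.IsHermitian) (hm0 : 0 < m)
    (hm : ∀ x, m * (x ⬝ᵥ x) ≤ x ⬝ᵥ A *ᵥ x) (hM : ∀ x, x ⬝ᵥ A *ᵥ x ≤ M * (x ⬝ᵥ x))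
    (s : ℝ) (x : ι → ℝ) :
    m * min (m ^ s) (M ^ s) * (x ⬝ᵥ x) ≤ x ⬝ᵥ (A * matrixRpow A s) *ᵥ x := by
  obtain ⟨P, hP, d, h, hd⟩ := exists_orthogonal_diagonal_mem_Icc hA hm hM
  have hP1 : P * Pᵀ = 1 := (Matrix.mem_orthogonalGroup_iff ι ℝ).1 hP
  have e : A * matrixRpow A s = Pᵀ * Matrix.diagonal (fun i => d i * d i ^ s) * P := by
    rw [matrixRpow_eq hP h, ← Matrix.diagonal_mul_diagonal]
    calc _ = Pᵀ * Matrix.diagonal d * (P * Pᵀ) * Matrix.diagonal (fun i => d i ^ s) * P := by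
          rw [h]; simp only [Matrix.mul_assoc]
      _ = _ := by rw [hP1, mul_one]; simp only [Matrix.mul_assoc]
  rw [e, dotProduct_conj_diagonal_mulVec, ← sum_sq_orthogonal_mulVec hP, Finset.mul_sum]
  refine Finset.sum_le_sum fun i _ => mul_le_mul_of_nonneg_right ?_ (sq_nonneg _)
  have hdi := hm0.trans_le (hd i).1
  exact mul_le_mul (hd i).1 (Real.min_rpow_le_rpow hm0 (hd i) s)
    (le_min (by positivity) (Real.rpow_nonneg (hdi.le.trans (hd i).2) _)) hdi.le

/-! ### Lipschitz dependence of matrix powers on the matrix -/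

theorem sum_sq_entries_eq_trace {ι : Type*} [Fintype ι] (N : Matrix ι ι ℝ) :
    ∑ i, ∑ j, N i j ^ 2 = (Nᵀ * N).trace := by
  simp only [Matrix.trace, Matrix.diag, Matrix.mul_apply, Matrix.transpose_apply, sq]
  exact Finset.sum_comm

theorem sum_sq_entries_orthogonal {ι : Type*} [Fintype ι] [DecidableEq ι] {P Q : Matrix ι ι ℝ}
    (hP : P ∈ Matrix.orthogonalGroup ι ℝ) (hQ : Q ∈ Matrix.orthogonalGroup ι ℝ)
    (N : Matrix ι ι ℝ) : ∑ i, ∑ j, (P * N * Qᵀ) i j ^ 2 = ∑ i, ∑ j, N i j ^ 2 := by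
  have hP2 : Pᵀ * P = 1 := (Matrix.mem_orthogonalGroup_iff' ι ℝ).1 hP
  have hQ2 : Qᵀ * Q = 1 := (Matrix.mem_orthogonalGroup_iff' ι ℝ).1 hQ
  rw [sum_sq_entries_eq_trace, sum_sq_entries_eq_trace]
  have : (P * N * Qᵀ)ᵀ * (P * N * Qᵀ) = Q * (Nᵀ * (Pᵀ * P) * N * Qᵀ) := by
    simp only [Matrix.transpose_mul, Matrix.transpose_transpose, Matrix.mul_assoc]
  rw [this, hP2, mul_one, Matrix.trace_mul_comm, Matrix.mul_assoc, hQ2, mul_one]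

/-- The functional calculus of a Lipschitz function is Lipschitz for the Frobenius norm. -/
theorem sum_sq_entries_conj_diagonal_sub_le {ι : Type*} [Fintype ι] [DecidableEq ι]
    {P Q : Matrix ι ι ℝ} (hP : P ∈ Matrix.orthogonalGroup ι ℝ)
    (hQ : Q ∈ Matrix.orthogonalGroup ι ℝ) {d e : ι → ℝ} {f : ℝ → ℝ} {L : ℝ}
    (hL : ∀ i j, |f (d i) - f (e j)| ≤ L * |d i - e j|) :
    ∑ i, ∑ j, (Pᵀ * Matrix.diagonal (fun i => f (d i)) * P
        - Qᵀ * Matrix.diagonal (fun i => f (e i)) * Q) i j ^ 2 ≤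
      L ^ 2 * ∑ i, ∑ j, (Pᵀ * Matrix.diagonal d * P - Qᵀ * Matrix.diagonal e * Q) i j ^ 2 := by
  have hP1 : P * Pᵀ = 1 := (Matrix.mem_orthogonalGroup_iff ι ℝ).1 hP
  have hQ1 : Q * Qᵀ = 1 := (Matrix.mem_orthogonalGroup_iff ι ℝ).1 hQ
  -- In the mixed basis, `P` on the left and `Q` on the right, the difference of the two matrices
  -- has entries `(a i - b j) * (P Qᵀ) i j`. Replacing `d`, `e` by `f ∘ d`, `f ∘ e` changes only the
  -- first factor, so the Lipschitz bound applies entry by entry and no eigenvectors have to be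
  -- compared.
  have key : ∀ (a b : ι → ℝ) (i j : ι), (P * (Pᵀ * Matrix.diagonal a * P
      - Qᵀ * Matrix.diagonal b * Q) * Qᵀ) i j = (a i - b j) * (P * Qᵀ) i j := by
    intro a b i j
    have : P * (Pᵀ * Matrix.diagonal a * P - Qᵀ * Matrix.diagonal b * Q) * Qᵀ =
        Matrix.diagonal a * (P * Qᵀ) - (P * Qᵀ) * Matrix.diagonal b := by
      calc _ = (P * Pᵀ) * Matrix.diagonal a * (P * Qᵀ)
            - (P * Qᵀ) * Matrix.diagonal b * (Q * Qᵀ) := by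
            simp only [Matrix.mul_sub, Matrix.sub_mul, Matrix.mul_assoc]
        _ = _ := by rw [hP1, hQ1, one_mul, mul_one]
    rw [this, Matrix.sub_apply, Matrix.diagonal_mul, Matrix.mul_diagonal]
    ring
  rw [← sum_sq_entries_orthogonal hP hQ, ← sum_sq_entries_orthogonal hP hQ
    (Pᵀ * Matrix.diagonal d * P - Qᵀ * Matrix.diagonal e * Q), Finset.mul_sum]
  simp only [key, Finset.mul_sum]
  gcongr with i _ j
  rw [← mul_pow, ← mul_assoc, mul_pow, mul_pow (L * _)]
  gcongr ?_ * _
  rw [← sq_abs, ← sq_abs (L * _), abs_mul L]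
  refine pow_le_pow_left₀ (abs_nonneg _) ((hL i j).trans ?_) 2
  gcongr
  exact le_abs_self L

/-- Passes from the Frobenius norm, which is orthogonally invariant, to single entries, which suit
the sup metric on `ι → ι → ℝ`. -/
theorem abs_entry_le_sum_of_sum_sq_le {ι : Type*} [Fintype ι] {N N' : Matrix ι ι ℝ} {L : ℝ}
    (hL : 0 ≤ L) (h : ∑ i, ∑ j, N i j ^ 2 ≤ L ^ 2 * ∑ i, ∑ j, N' i j ^ 2) (i j : ι) :
    |N i j| ≤ L * ∑ k, ∑ l, |N' k l| := by
  refine abs_le_of_sq_le_sq ?_ (by positivity)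
  calc N i j ^ 2 ≤ ∑ l, N i l ^ 2 :=
        Finset.single_le_sum (f := fun l => N i l ^ 2) (fun _ _ => sq_nonneg _) (Finset.mem_univ j)
    _ ≤ ∑ k, ∑ l, N k l ^ 2 := Finset.single_le_sum (f := fun k => ∑ l, N k l ^ 2)
        (fun _ _ => Finset.sum_nonneg fun _ _ => sq_nonneg _) (Finset.mem_univ i)
    _ ≤ L ^ 2 * ∑ i, ∑ j, N' i j ^ 2 := h
    _ = L ^ 2 * ∑ x : ι × ι, |N' x.1 x.2| ^ 2 := by
        simp only [sq_abs, Fintype.sum_prod_type]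
    _ ≤ L ^ 2 * (∑ x : ι × ι, |N' x.1 x.2|) ^ 2 := by
        gcongr
        exact Finset.sum_sq_le_sq_sum_of_nonneg fun _ _ => abs_nonneg _
    _ = (L * ∑ k, ∑ l, |N' k l|) ^ 2 := by rw [mul_pow, Fintype.sum_prod_type]

theorem Real.exists_abs_rpow_sub_rpow_le {m : ℝ} (M : ℝ) (hm : 0 < m) (s : ℝ) :
    ∃ L ≥ 0, ∀ x ∈ Set.Icc m M, ∀ y ∈ Set.Icc m M, |x ^ s - y ^ s| ≤ L * |x - y| := by
  have hc : ContDiffOn ℝ 1 (fun x : ℝ => x ^ s) (Set.Icc m M) := fun x hx =>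
    (Real.contDiffAt_rpow_const_of_ne (hm.trans_le hx.1).ne').contDiffWithinAt
  obtain ⟨L, hL⟩ := hc.exists_lipschitzOnWith one_ne_zero (convex_Icc m M) isCompact_Icc
  exact ⟨L, L.2, fun x hx y hy => by simpa [Real.dist_eq] using hL.dist_le_mul x hx y hy⟩

/-- Real powers are Lipschitz on the symmetric matrices with spectrum in a compact subset of
`(0, ∞)`. -/
theorem exists_abs_matrixRpow_sub_le {ι : Type*} [Fintype ι] [DecidableEq ι] {m : ℝ} (M : ℝ)
    (hm0 : 0 < m) (s : ℝ) : ∃ L ≥ 0, ∀ A B : Matrix ι ι ℝ, A.IsHermitian → B.IsHermitian →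
      (∀ x, m * (x ⬝ᵥ x) ≤ x ⬝ᵥ A *ᵥ x) → (∀ x, x ⬝ᵥ A *ᵥ x ≤ M * (x ⬝ᵥ x)) →
      (∀ x, m * (x ⬝ᵥ x) ≤ x ⬝ᵥ B *ᵥ x) → (∀ x, x ⬝ᵥ B *ᵥ x ≤ M * (x ⬝ᵥ x)) →
      ∀ i j, |matrixRpow A s i j - matrixRpow B s i j| ≤ L * ∑ k, ∑ l, |A k l - B k l| := by
  obtain ⟨L, hL0, hL⟩ := Real.exists_abs_rpow_sub_rpow_le M hm0 s
  refine ⟨L, hL0, fun A B hA hB hAm hAM hBm hBM i j => ?_⟩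
  obtain ⟨P, hP, d, hd, hd'⟩ := exists_orthogonal_diagonal_mem_Icc hA hAm hAM
  obtain ⟨Q, hQ, e, he, he'⟩ := exists_orthogonal_diagonal_mem_Icc hB hBm hBM
  have h := sum_sq_entries_conj_diagonal_sub_le hP hQ (f := fun x => x ^ s)
    (fun i j => hL _ (hd' i) _ (he' j))
  rw [← matrixRpow_eq hP hd, ← matrixRpow_eq hQ he, ← hd, ← he] at h
  exact abs_entry_le_sum_of_sum_sq_le hL0 h i j

/-! ### Flows of locally Lipschitz vector fields with a compact forward invariant set -/

/-- `γ` is an integral curve in `W` of the vector field `f` on the interval `[a, b]`. -/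
def IsCurveOn {E : Type*} [NormedAddCommGroup E] [NormedSpace ℝ E] (f : E → E) (W : Set E)
    (γ : ℝ → E) (a b : ℝ) : Prop :=
  ∀ t ∈ Set.Icc a b, γ t ∈ W ∧ HasDerivWithinAt γ (f (γ t)) (Set.Icc a b) t

/-- Integral curves in `W` which start in `Q` stay in `Q`. -/
def IsCurveInvariant {E : Type*} [NormedAddCommGroup E] [NormedSpace ℝ E] (f : E → E)
    (W Q : Set E) : Prop :=
  ∀ (γ : ℝ → E) (a b : ℝ), a ≤ b → IsCurveOn f W γ a b → γ a ∈ Q → γ b ∈ Q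

/-- A curve of speed at most `L` stays in the ball of radius `L * T`, so the global bound lets a
single application of Picard–Lindelöf cover all of `[0, T]`. -/
theorem exists_curve_of_lipschitzWith {E : Type*} [NormedAddCommGroup E] [NormedSpace ℝ E]
    [CompleteSpace E] {f : E → E} {K L : NNReal} (hK : LipschitzWith K f) (hL : ∀ x, ‖f x‖ ≤ L)
    (x₀ : E) {T : ℝ} (hT : 0 ≤ T) : ∃ γ : ℝ → E, γ 0 = x₀ ∧
      ∀ t ∈ Set.Icc 0 T, HasDerivWithinAt γ (f (γ t)) (Set.Icc 0 T) t := by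
  have h : IsPicardLindelof (fun _ => f) (⟨0, Set.left_mem_Icc.2 hT⟩ : Set.Icc 0 T) x₀
      (L * ⟨T, hT⟩) 0 L K := by
    refine IsPicardLindelof.of_time_independent (fun x _ => hL x) hK.lipschitzOnWith ?_
    simp [hT]; rfl
  exact h.exists_eq_forall_mem_Icc_hasDerivWithinAt₀

/-- After a coordinatewise Lipschitz extension, each coordinate is truncated to `[-L, L]`.
Truncation is 1-Lipschitz and changes nothing on `S`, where `L` already bounds `f`. -/
theorem exists_bounded_lipschitzWith_extension {ι : Type*} [Fintype ι] {S : Set (ι → ℝ)}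
    {f : (ι → ℝ) → ι → ℝ} {K : NNReal} (hS : IsCompact S) (hf : LipschitzOnWith K f S) :
    ∃ g : (ι → ℝ) → ι → ℝ, LipschitzWith K g ∧ (∃ L : NNReal, ∀ x, ‖g x‖ ≤ L) ∧
      Set.EqOn f g S := by
  obtain ⟨g, hg, hfg⟩ := hf.extend_pi
  obtain ⟨R, hR⟩ := hS.exists_bound_of_continuousOn hf.continuousOn
  set L : ℝ := max R 0
  have hL0 : 0 ≤ L := le_max_right _ _
  have hfL : ∀ x ∈ S, ‖f x‖ ≤ L := fun x hx => (hR x hx).trans (le_max_left _ _)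
  refine ⟨fun x i => max (-L) (min L (g x i)), ?_, ⟨⟨L, hL0⟩, fun x => ?_⟩, fun x hx => ?_⟩
  · refine LipschitzWith.of_dist_le_mul fun x y => (dist_pi_le_iff (by positivity)).2 fun i => ?_
    calc |max (-L) (min L (g x i)) - max (-L) (min L (g y i))|
        ≤ |g x i - g y i| := by
          rw [max_comm (-L), max_comm (-L), min_comm L, min_comm L]
          exact (abs_max_sub_max_le_abs _ _ _).trans (abs_inf_sub_inf_le_abs _ _ _)
      _ ≤ dist (g x) (g y) := dist_le_pi_dist (g x) (g y) i
      _ ≤ K * dist x y := hg.dist_le_mul x y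
  · refine (pi_norm_le_iff_of_nonneg hL0).2 fun i => ?_
    rw [Real.norm_eq_abs, abs_le]
    exact ⟨le_max_left _ _, max_le (by linarith) (min_le_left _ _)⟩
  · funext i
    have h := (norm_le_pi_norm (f x) i).trans (hfL x hx)
    rw [Real.norm_eq_abs, abs_le] at h
    have e : f x i = g x i := congrFun (hfg hx) i
    simp only [← e]
    rw [min_eq_right h.2, max_eq_right h.1]

theorem IsCurveOn.mono {E : Type*} [NormedAddCommGroup E] [NormedSpace ℝ E] {f : E → E}
    {W : Set E} {γ : ℝ → E} {a b c d : ℝ} (h : IsCurveOn f W γ a b) (hac : a ≤ c) (hdb : d ≤ b) :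
    IsCurveOn f W γ c d := fun t ht =>
  ⟨(h t (Set.Icc_subset_Icc hac hdb ht)).1,
    (h t (Set.Icc_subset_Icc hac hdb ht)).2.mono (Set.Icc_subset_Icc hac hdb)⟩

theorem IsCurveOn.continuousOn {E : Type*} [NormedAddCommGroup E] [NormedSpace ℝ E] {f : E → E}
    {W : Set E} {γ : ℝ → E} {a b : ℝ} (h : IsCurveOn f W γ a b) :
    ContinuousOn γ (Set.Icc a b) := fun t ht => (h t ht).2.continuousWithinAt

theorem IsCurveInvariant.mem {E : Type*} [NormedAddCommGroup E] [NormedSpace ℝ E] {f : E → E}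
    {W Q : Set E} (hQ : IsCurveInvariant f W Q) {γ : ℝ → E} {a b : ℝ}
    (h : IsCurveOn f W γ a b) (ha : γ a ∈ Q) {t : ℝ} (ht : t ∈ Set.Icc a b) : γ t ∈ Q :=
  hQ γ a t ht.1 (h.mono le_rfl ht.2) ha

/-- The field is replaced by a bounded, globally Lipschitz one that agrees with it on a compact
neighbourhood `S` of `Q`. The solution of the modified equation never leaves `Q`, hence solves the
original one. -/
theorem exists_curve_of_isForwardInvariant {ι : Type*} [Fintype ι] {f : (ι → ℝ) → ι → ℝ}
    {W Q : Set (ι → ℝ)} (hW : IsOpen W) (hf : LocallyLipschitzOn W f) (hQ : IsCompact Q)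
    (hQW : Q ⊆ W) (hinv : IsCurveInvariant f W Q) {x₀ : ι → ℝ} (hx₀ : x₀ ∈ Q) {T : ℝ}
    (hT : 0 ≤ T) : ∃ γ : ℝ → ι → ℝ, γ 0 = x₀ ∧ IsCurveOn f W γ 0 T := by
  obtain ⟨S, hS, hQS, hSW⟩ := exists_compact_between hQ hW hQW
  obtain ⟨K, hK⟩ := (hf.mono hSW).exists_lipschitzOnWith_of_compact hS
  obtain ⟨g, hg, ⟨L, hL⟩, hfg⟩ := exists_bounded_lipschitzWith_extension hS hK
  obtain ⟨γ, h0, hγ⟩ := exists_curve_of_lipschitzWith hg hL x₀ hT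
  have hcont : ContinuousOn γ (Set.Icc 0 T) := fun t ht => (hγ t ht).continuousWithinAt
  -- Continuous induction: the times at which the curve is in `Q` form a closed set, and after such
  -- a time the curve remains in `S` for a while. There it is an integral curve of `f`, so
  -- invariance keeps it in `Q`.
  have hmem : Set.Icc 0 T ⊆ {t | γ t ∈ Q} := by
    refine IsClosed.Icc_subset_of_forall_mem_nhdsWithin ?_ (by simpa [h0] using hx₀) ?_
    · rw [Set.inter_comm]
      exact hcont.preimage_isClosed_of_isClosed isClosed_Icc hQ.isClosed
    · rintro t ⟨htQ, ht0, htT⟩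
      have h1 : γ ⁻¹' interior S ∈ nhdsWithin t (Set.Icc 0 T) :=
        hcont t ⟨ht0, htT.le⟩ (isOpen_interior.mem_nhds (hQS htQ))
      have h2 : γ ⁻¹' interior S ∈ nhdsWithin t (Set.Ici t) := by
        rw [← nhdsWithin_Icc_eq_nhdsGE htT]
        exact nhdsWithin_mono t (Set.Icc_subset_Icc_left ht0) h1
      obtain ⟨u, hu, huS⟩ := (mem_nhdsGE_iff_exists_Icc_subset).1 h2
      have hu : t < u := hu
      filter_upwards [Ioc_mem_nhdsGT (lt_min hu htT)] with r hr
      refine hinv γ t r hr.1.le (fun q hq => ?_) htQ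
      have hqS : γ q ∈ S := interior_subset
        (huS ⟨hq.1, hq.2.trans (hr.2.trans (min_le_left _ _))⟩)
      have hrT : r ≤ T := hr.2.trans (min_le_right _ _)
      refine ⟨hSW hqS, ?_⟩
      rw [hfg hqS]
      exact (hγ q ⟨ht0.trans hq.1, hq.2.trans hrT⟩).mono (Set.Icc_subset_Icc ht0 hrT)
  refine ⟨γ, h0, fun t ht => ⟨hQW (hmem ht), ?_⟩⟩
  rw [hfg (interior_subset (hQS (hmem ht)))]
  exact hγ t ht

/-- Invariance confines both curves to `Q`, and a locally Lipschitz field has one Lipschitz constant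
on a compact set, so Grönwall's uniqueness applies. -/
theorem IsCurveOn.eqOn {ι : Type*} [Fintype ι] {f : (ι → ℝ) → ι → ℝ}
    {W Q : Set (ι → ℝ)} (hf : LocallyLipschitzOn W f) (hQ : IsCompact Q)
    (hQW : Q ⊆ W) (hinv : IsCurveInvariant f W Q) {γ δ : ℝ → ι → ℝ} {T : ℝ}
    (hγ : IsCurveOn f W γ 0 T) (hδ : IsCurveOn f W δ 0 T) (h0 : γ 0 ∈ Q) (h : γ 0 = δ 0) :
    Set.EqOn γ δ (Set.Icc 0 T) := by
  obtain ⟨K, hK⟩ := (hf.mono hQW).exists_lipschitzOnWith_of_compact hQ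
  have key : ∀ {η : ℝ → ι → ℝ}, IsCurveOn f W η 0 T → ∀ t ∈ Set.Ico 0 T,
      HasDerivWithinAt η (f (η t)) (Set.Ici t) t := by
    intro η hη t ht
    have h1 := (hη t ⟨ht.1, ht.2.le⟩).2
    have h2 : HasDerivWithinAt η (f (η t)) (Set.Icc t T) t :=
      h1.mono (Set.Icc_subset_Icc_left ht.1)
    exact h2.mono_of_mem_nhdsWithin (Icc_mem_nhdsGE ht.2)
  exact ODE_solution_unique_of_mem_Icc_right (v := fun _ => f) (s := fun _ => Q) (K := K)
    (fun _ _ => hK) hγ.continuousOn (key hγ)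
    (fun t ht => hinv.mem hγ h0 ⟨ht.1, ht.2.le⟩) hδ.continuousOn (key hδ)
    (fun t ht => hinv.mem hδ (h ▸ h0) ⟨ht.1, ht.2.le⟩) h

/-- A locally Lipschitz vector field with a compact forward invariant set has a unique integral
curve for all positive times, from each point of this set. -/
theorem exists_global_curve {ι : Type*} [Fintype ι] {f : (ι → ℝ) → ι → ℝ}
    {W Q : Set (ι → ℝ)} (hW : IsOpen W) (hf : LocallyLipschitzOn W f) (hQ : IsCompact Q)
    (hQW : Q ⊆ W) (hinv : IsCurveInvariant f W Q) {x₀ : ι → ℝ} (hx₀ : x₀ ∈ Q) :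
    ∃ γ : ℝ → ι → ℝ, γ 0 = x₀ ∧ (∀ t ≥ 0, γ t ∈ Q) ∧
      (∀ t ≥ 0, HasDerivWithinAt γ (f (γ t)) (Set.Ici 0) t) ∧ ∀ T, IsCurveOn f W γ 0 T := by
  have hex : ∀ n : ℕ, ∃ γ : ℝ → ι → ℝ, γ 0 = x₀ ∧ IsCurveOn f W γ 0 n := fun n =>
    exists_curve_of_isForwardInvariant hW hf hQ hQW hinv hx₀ n.cast_nonneg
  choose c hc0 hc using hex
  -- The horizon `⌊t⌋₊ + 1` exceeds `t`; uniqueness makes the choice of a horizon beyond `t`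
  -- immaterial.
  set γ : ℝ → ι → ℝ := fun t => c (⌊t⌋₊ + 1) t with hγ
  have heq : ∀ n : ℕ, ∀ t : ℝ, 0 ≤ t → t ≤ n → γ t = c n t := by
    intro n t h0 hn
    have h1 : t ≤ ((⌊t⌋₊ + 1 : ℕ) : ℝ) := by exact_mod_cast (Nat.lt_floor_add_one t).le
    rcases le_total n (⌊t⌋₊ + 1) with h | h
    · exact ((hc _).mono le_rfl (Nat.cast_le.2 h)).eqOn hf hQ hQW hinv (hc n)
        (by rw [hc0]; exact hx₀) (by rw [hc0, hc0]) ⟨h0, hn⟩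
    · exact (hc _).eqOn hf hQ hQW hinv ((hc n).mono le_rfl (Nat.cast_le.2 h))
        (by rw [hc0]; exact hx₀) (by rw [hc0, hc0]) ⟨h0, h1⟩
  have hmem : ∀ t ≥ 0, γ t ∈ Q := by
    intro t ht
    obtain ⟨n, hn⟩ := exists_nat_ge t
    rw [heq n t ht hn]
    exact hinv.mem (hc n) (by rw [hc0]; exact hx₀) ⟨ht, hn⟩
  have hder : ∀ t ≥ 0, HasDerivWithinAt γ (f (γ t)) (Set.Ici 0) t := by
    intro t ht
    obtain ⟨n, hn⟩ := exists_nat_gt t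
    have h1 : HasDerivWithinAt γ (f (γ t)) (Set.Icc 0 n) t := by
      rw [heq n t ht hn.le]
      exact ((hc n) t ⟨ht, hn.le⟩).2.congr (fun r hr => heq n r hr.1 hr.2) (heq n t ht hn.le)
    refine h1.mono_of_mem_nhdsWithin ?_
    rw [← Set.Ici_inter_Iic]
    exact Filter.inter_mem self_mem_nhdsWithin (mem_nhdsWithin_of_mem_nhds (Iic_mem_nhds hn))
  refine ⟨γ, by simpa [hc0] using heq 0 0 le_rfl (by simp), hmem, hder, fun T t ht => ?_⟩
  exact ⟨hQW (hmem t ht.1), (hder t ht.1).mono Set.Icc_subset_Ici_self⟩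

/-! ### Curvature maps -/

/-- The Jacobian matrix of a self-map of `ℝ^ι`. -/
noncomputable def jacobian {ι : Type*} [Fintype ι] [DecidableEq ι] (K : (ι → ℝ) → ι → ℝ)
    (w : ι → ℝ) : Matrix ι ι ℝ :=
  Matrix.of fun i j => fderiv ℝ K w (Pi.single j 1) i

theorem jacobian_mulVec {ι : Type*} [Fintype ι] [DecidableEq ι] (K : (ι → ℝ) → ι → ℝ)
    (w v : ι → ℝ) : jacobian K w *ᵥ v = fderiv ℝ K w v :=
  LinearMap.toMatrix'_mulVec (fderiv ℝ K w : (ι → ℝ) →ₗ[ℝ] ι → ℝ) v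

/-- A positive map on an open convex domain, with a negative definite Jacobian matrix, and with
the properness which makes the associated flows complete. -/
structure IsCurvatureMap {ι : Type*} [Fintype ι] [DecidableEq ι] (W : Set (ι → ℝ))
    (K : (ι → ℝ) → ι → ℝ) : Prop where
  isOpen : IsOpen W
  convex : Convex ℝ W
  nonempty : W.Nonempty
  contDiffOn : ContDiffOn ℝ 2 K W
  pos : ∀ w ∈ W, ∀ i, 0 < K w i
  posDef : ∀ w ∈ W, (-jacobian K w).PosDef
  exists_compact_of_mem_Icc : ∀ m > 0, ∀ M, ∃ Q ⊆ W, IsCompact Q ∧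
    ∀ w ∈ W, (∀ i, K w i ∈ Set.Icc m M) → w ∈ Q
  exists_compact_of_le : ∀ M R, ∃ Q ⊆ W, IsCompact Q ∧
    ∀ w ∈ W, (∀ i, K w i ≤ M) → ‖w‖ ≤ R → w ∈ Q

/-- The vector field of the flow `dw/dt = -(-J)^s (K̄ - K)`. -/
noncomputable def fractionalField {ι : Type*} [Fintype ι] [DecidableEq ι] (K : (ι → ℝ) → ι → ℝ)
    (Kbar : ι → ℝ) (s : ℝ) (w : ι → ℝ) : ι → ℝ :=
  (-matrixRpow (-jacobian K w) s) *ᵥ (Kbar - K w)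

theorem fractionalField_eq {ι : Type*} [Fintype ι] [DecidableEq ι] (K : (ι → ℝ) → ι → ℝ)
    (Kbar : ι → ℝ) (s : ℝ) (w : ι → ℝ) :
    fractionalField K Kbar s w = matrixRpow (-jacobian K w) s *ᵥ (K w - Kbar) := by
  rw [fractionalField, Matrix.neg_mulVec, ← Matrix.mulVec_neg, neg_sub]

theorem LocallyLipschitz.comp_locallyLipschitzOn {α β γ : Type*} [PseudoEMetricSpace α]
    [PseudoEMetricSpace β] [PseudoEMetricSpace γ] {g : β → γ} {f : α → β} {s : Set α}
    (hg : LocallyLipschitz g) (hf : LocallyLipschitzOn s f) : LocallyLipschitzOn s (g ∘ f) := by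
  intro x hx
  obtain ⟨L, t, ht, hL⟩ := hf hx
  obtain ⟨M, u, hu, hM⟩ := hg (f x)
  have hc : ContinuousWithinAt f s x := hf.continuousOn x hx
  refine ⟨M * L, t ∩ f ⁻¹' u, Filter.inter_mem ht (hc hu), ?_⟩
  exact hM.comp (hL.mono Set.inter_subset_left) fun y hy => hy.2

theorem LocallyLipschitzOn.prodMk {α β γ : Type*} [PseudoEMetricSpace α]
    [PseudoEMetricSpace β] [PseudoEMetricSpace γ] {f : α → β} {g : α → γ} {s : Set α}
    (hf : LocallyLipschitzOn s f) (hg : LocallyLipschitzOn s g) :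
    LocallyLipschitzOn s fun x => (f x, g x) := by
  intro x hx
  obtain ⟨L, t, ht, hL⟩ := hf hx
  obtain ⟨M, u, hu, hM⟩ := hg hx
  exact ⟨max L M, t ∩ u, Filter.inter_mem ht hu, (hL.mono Set.inter_subset_left).prodMk
    (hM.mono Set.inter_subset_right)⟩

theorem dotProduct_self_pos_of_ne_zero {ι : Type*} [Fintype ι] {x : ι → ℝ} (hx : x ≠ 0) :
    0 < x ⬝ᵥ x :=
  lt_of_le_of_ne (Finset.sum_nonneg fun i _ => mul_self_nonneg (x i))
    fun h => hx (dotProduct_self_eq_zero.1 h.symm)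

/-- On a compact set, a continuous family of positive definite matrices is uniformly bounded
from below and above. -/
theorem exists_bounds_of_posDef {α ι : Type*} [TopologicalSpace α] [Fintype ι]
    {A : α → Matrix ι ι ℝ} {Q : Set α} (hQ : IsCompact Q) (hA : ContinuousOn A Q)
    (hpos : ∀ w ∈ Q, (A w).PosDef) : ∃ m > 0, ∃ M, ∀ w ∈ Q, ∀ x : ι → ℝ,
      m * (x ⬝ᵥ x) ≤ x ⬝ᵥ A w *ᵥ x ∧ x ⬝ᵥ A w *ᵥ x ≤ M * (x ⬝ᵥ x) := by
  have hS : IsCompact {x : ι → ℝ | x ⬝ᵥ x = 1} := by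
    refine (isCompact_closedBall (0 : ι → ℝ) 1).of_isClosed_subset
      (isClosed_eq (by fun_prop) continuous_const) fun x hx => ?_
    rw [mem_closedBall_zero_iff, pi_norm_le_iff_of_nonneg zero_le_one]
    intro i
    rw [Real.norm_eq_abs, ← sq_le_one_iff_abs_le_one, ← show x ⬝ᵥ x = 1 from hx, sq]
    exact Finset.single_le_sum (f := fun i => x i * x i) (fun i _ => mul_self_nonneg _)
      (Finset.mem_univ i)
  have hc : ContinuousOn (fun p : α × (ι → ℝ) => p.2 ⬝ᵥ A p.1 *ᵥ p.2)
      (Q ×ˢ {x : ι → ℝ | x ⬝ᵥ x = 1}) := by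
    have h1 : ContinuousOn (fun p : α × (ι → ℝ) => A p.1) (Q ×ˢ {x : ι → ℝ | x ⬝ᵥ x = 1}) :=
      hA.comp continuousOn_fst fun p hp => hp.1
    have h2 : Continuous fun p : Matrix ι ι ℝ × (ι → ℝ) => p.2 ⬝ᵥ p.1 *ᵥ p.2 := by fun_prop
    exact h2.comp_continuousOn (h1.prodMk continuousOn_snd)
  obtain ⟨m, hm, h1⟩ := (hQ.prod hS).exists_forall_le' hc (a := 0) (by
    rintro ⟨w, x⟩ ⟨hw, hx⟩
    have hx0 : x ≠ 0 := by
      rintro rfl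
      simp at hx
    simpa using (hpos w hw).dotProduct_mulVec_pos hx0)
  obtain ⟨M, h2⟩ := (hQ.prod hS).exists_bound_of_continuousOn hc
  refine ⟨m, hm, M, fun w hw x => ?_⟩
  rcases eq_or_ne x 0 with rfl | hx
  · simp
  have hr := dotProduct_self_pos_of_ne_zero hx
  -- The bounds on the Euclidean unit sphere carry over to `x` because the form is homogeneous of
  -- degree two.
  set r := √(x ⬝ᵥ x) with hr_def
  have hr0 : 0 < r := Real.sqrt_pos.2 hr
  have hr2 : r ^ 2 = x ⬝ᵥ x := Real.sq_sqrt hr.le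
  have hy : (r⁻¹ • x) ⬝ᵥ (r⁻¹ • x) = 1 := by
    rw [smul_dotProduct, dotProduct_smul, ← hr2]
    simp only [smul_eq_mul]
    field_simp
  have e : x ⬝ᵥ A w *ᵥ x = r ^ 2 * ((r⁻¹ • x) ⬝ᵥ A w *ᵥ (r⁻¹ • x)) := by
    rw [Matrix.mulVec_smul, smul_dotProduct, dotProduct_smul]
    simp only [smul_eq_mul]
    field_simp
  have h1' := h1 (w, r⁻¹ • x) ⟨hw, hy⟩
  have h2' := (le_abs_self _).trans (h2 (w, r⁻¹ • x) ⟨hw, hy⟩)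
  rw [e, ← hr2, mul_comm m, mul_comm M]
  exact ⟨by gcongr, by gcongr⟩

namespace IsCurvatureMap

variable {ι : Type*} [Fintype ι] [DecidableEq ι] {W : Set (ι → ℝ)} {K : (ι → ℝ) → ι → ℝ}

theorem hasFDerivAt (h : IsCurvatureMap W K) {w : ι → ℝ} (hw : w ∈ W) :
    HasFDerivAt K (fderiv ℝ K w) w :=
  ((h.contDiffOn.differentiableOn (by norm_num)).differentiableAt
    (h.isOpen.mem_nhds hw)).hasFDerivAt

theorem continuousOn (h : IsCurvatureMap W K) : ContinuousOn K W := h.contDiffOn.continuousOn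

theorem locallyLipschitzOn (h : IsCurvatureMap W K) : LocallyLipschitzOn W K :=
  (h.contDiffOn.of_le (by norm_num)).locallyLipschitzOn h.convex

theorem contDiffOn_fderiv (h : IsCurvatureMap W K) : ContDiffOn ℝ 1 (fderiv ℝ K) W :=
  h.contDiffOn.fderiv_of_isOpen h.isOpen (by norm_num)

theorem locallyLipschitzOn_jacobian (h : IsCurvatureMap W K) :
    LocallyLipschitzOn W (fun w => (fun i j => (-jacobian K w) i j : ι → ι → ℝ)) := by
  refine ContDiffOn.locallyLipschitzOn h.convex ?_
  refine contDiffOn_pi.2 fun i => contDiffOn_pi.2 fun j => ?_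
  have h1 : ContDiffOn ℝ 1 (fun w => fderiv ℝ K w (Pi.single j 1)) W :=
    h.contDiffOn_fderiv.clm_apply contDiffOn_const
  exact ((contDiff_apply ℝ ℝ i).comp_contDiffOn h1).neg

theorem continuousOn_jacobian (h : IsCurvatureMap W K) :
    ContinuousOn (fun w => -jacobian K w) W :=
  h.locallyLipschitzOn_jacobian.continuousOn

theorem exists_bounds (h : IsCurvatureMap W K) {Q : Set (ι → ℝ)} (hQ : IsCompact Q)
    (hQW : Q ⊆ W) : ∃ m > 0, ∃ M, ∀ w ∈ Q, ∀ x : ι → ℝ,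
      m * (x ⬝ᵥ x) ≤ x ⬝ᵥ (-jacobian K w) *ᵥ x ∧
        x ⬝ᵥ (-jacobian K w) *ᵥ x ≤ M * (x ⬝ᵥ x) :=
  exists_bounds_of_posDef hQ (h.continuousOn_jacobian.mono hQW) fun w hw => h.posDef w (hQW hw)

/-- Near a point the matrices `-J` have spectra in one interval `[m, M]` with `m > 0`. On such
matrices the power is Lipschitz, and `-J` itself is locally Lipschitz because `K` is C². -/
theorem locallyLipschitzOn_matrixRpow (h : IsCurvatureMap W K) (s : ℝ) :
    LocallyLipschitzOn W
      (fun w => (fun i j => matrixRpow (-jacobian K w) s i j : ι → ι → ℝ)) := by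
  intro w hw
  obtain ⟨C, t, ht, hC⟩ := h.locallyLipschitzOn_jacobian hw
  obtain ⟨Q, hQ, hwQ, hQW⟩ := exists_compact_subset h.isOpen hw
  obtain ⟨m, hm, M, hb⟩ := h.exists_bounds hQ hQW
  obtain ⟨L, hL0, hL⟩ := exists_abs_matrixRpow_sub_le (ι := ι) M hm s
  lift L to NNReal using hL0
  -- The entrywise estimate sums the differences of all entries of the Jacobian, each at most `C *
  -- dist x y`; hence the squared cardinality.
  refine ⟨L * (Fintype.card ι * (Fintype.card ι * C)), t ∩ Q,
    Filter.inter_mem ht (mem_nhdsWithin_of_mem_nhds (mem_interior_iff_mem_nhds.1 hwQ)), ?_⟩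
  refine LipschitzOnWith.of_dist_le_mul fun x hx y hy => ?_
  refine (dist_pi_le_iff (by positivity)).2 fun i => (dist_pi_le_iff (by positivity)).2 fun j => ?_
  refine (hL _ _ (h.posDef x (hQW hx.2)).isHermitian (h.posDef y (hQW hy.2)).isHermitian
    (fun z => (hb x hx.2 z).1) (fun z => (hb x hx.2 z).2)
    (fun z => (hb y hy.2 z).1) (fun z => (hb y hy.2 z).2) i j).trans ?_
  have e : ∀ k l, |(-jacobian K x) k l - (-jacobian K y) k l| ≤ C * dist x y := fun k l =>
    ((dist_le_pi_dist (fun l => (-jacobian K x) k l) (fun l => (-jacobian K y) k l) l).trans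
      (dist_le_pi_dist (fun k l => (-jacobian K x) k l) (fun k l => (-jacobian K y) k l) k)).trans
      (hC.dist_le_mul x hx.1 y hy.1)
  calc L * ∑ k, ∑ l, |(-jacobian K x) k l - (-jacobian K y) k l|
      ≤ L * ∑ _k : ι, ∑ _l : ι, C * dist x y := by gcongr with k _ l _; exact e k l
    _ = _ := by
      simp only [Finset.sum_const, Finset.card_univ, nsmul_eq_mul, NNReal.coe_mul,
        NNReal.coe_natCast]
      ring

theorem locallyLipschitzOn_fractionalField (h : IsCurvatureMap W K) (Kbar : ι → ℝ) (s : ℝ) :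
    LocallyLipschitzOn W (fractionalField K Kbar s) := by
  have h1 := (h.locallyLipschitzOn_matrixRpow s).prodMk h.locallyLipschitzOn
  have h2 : ContDiff ℝ 1 fun p : (ι → ι → ℝ) × (ι → ℝ) =>
      fun i => ∑ j, p.1 i j * (p.2 j - Kbar j) := by fun_prop
  have h3 := h2.locallyLipschitz.comp_locallyLipschitzOn h1
  have e : fractionalField K Kbar s = _ := funext fun w => fractionalField_eq K Kbar s w
  rw [e]
  exact h3

end IsCurvatureMap

/-! ### Monotonicity, expansion and surjectivity of curvature maps -/

theorem hasDerivAt_add_smul {ι : Type*} [Fintype ι] (p v : ι → ℝ) (τ : ℝ) :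
    HasDerivAt (fun τ : ℝ => p + τ • v) v τ := by
  simpa using ((hasDerivAt_id τ).smul_const v).const_add p

theorem HasDerivAt.const_dotProduct {ι : Type*} [Fintype ι] {f : ℝ → ι → ℝ} {f' : ι → ℝ} {t : ℝ} (v : ι → ℝ)
    (hf : HasDerivAt f f' t) : HasDerivAt (fun t => v ⬝ᵥ f t) (v ⬝ᵥ f') t := by
  simp only [dotProduct]
  exact HasDerivAt.fun_sum fun i _ => (hasDerivAt_pi.1 hf i).const_mul (v i)

theorem dotProduct_sq_le {ι : Type*} [Fintype ι] (x y : ι → ℝ) : (x ⬝ᵥ y) ^ 2 ≤ (x ⬝ᵥ x) * (y ⬝ᵥ y) := by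
  have := Finset.sum_mul_sq_le_sq_mul_sq Finset.univ x y
  simpa only [dotProduct, ← sq] using this

namespace IsCurvatureMap

variable {ι : Type*} [Fintype ι] [DecidableEq ι] {W : Set (ι → ℝ)} {K : (ι → ℝ) → ι → ℝ}

theorem line_mem (h : IsCurvatureMap W K) {p q : ι → ℝ} (hp : p ∈ W) (hq : q ∈ W) {τ : ℝ}
    (hτ : τ ∈ Set.Icc (0 : ℝ) 1) : p + τ • (q - p) ∈ W :=
  h.convex.add_smul_sub_mem hp hq hτ

/-- The mean value theorem for the map `K` in the direction of a segment. -/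
theorem exists_dotProduct_sub_eq (h : IsCurvatureMap W K) {p q : ι → ℝ} (hp : p ∈ W)
    (hq : q ∈ W) : ∃ τ ∈ Set.Icc (0 : ℝ) 1, (q - p) ⬝ᵥ (K p - K q) =
      (q - p) ⬝ᵥ (-jacobian K (p + τ • (q - p))) *ᵥ (q - p) := by
  have hd : ∀ τ ∈ Set.Icc (0 : ℝ) 1, HasDerivAt (fun τ : ℝ => (q - p) ⬝ᵥ K (p + τ • (q - p)))
      ((q - p) ⬝ᵥ jacobian K (p + τ • (q - p)) *ᵥ (q - p)) τ := by
    intro τ hτ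
    rw [jacobian_mulVec]
    exact HasDerivAt.const_dotProduct _
      ((h.hasFDerivAt (h.line_mem hp hq hτ)).comp_hasDerivAt τ (hasDerivAt_add_smul p (q - p) τ))
  obtain ⟨τ, hτ, e⟩ := exists_hasDerivAt_eq_slope _ _ zero_lt_one
    (fun τ hτ => (hd τ hτ).continuousAt.continuousWithinAt)
    (fun τ hτ => hd τ (Set.Ioo_subset_Icc_self hτ))
  refine ⟨τ, Set.Ioo_subset_Icc_self hτ, ?_⟩
  rw [Matrix.neg_mulVec, dotProduct_neg, e, ← neg_sub (K q), dotProduct_neg, dotProduct_sub]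
  simp

/-- Strict monotonicity of `-K`: along the segment, which convexity keeps in `W`, the derivative of
`K` is negative definite. -/
theorem dotProduct_sub_pos (h : IsCurvatureMap W K) {p q : ι → ℝ} (hp : p ∈ W)
    (hq : q ∈ W) (hpq : p ≠ q) : 0 < (q - p) ⬝ᵥ (K p - K q) := by
  obtain ⟨τ, hτ, e⟩ := h.exists_dotProduct_sub_eq hp hq
  rw [e]
  simpa using (h.posDef _ (h.line_mem hp hq hτ)).dotProduct_mulVec_pos (sub_ne_zero.2 hpq.symm)

theorem injOn (h : IsCurvatureMap W K) : Set.InjOn K W := by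
  intro p hp q hq e
  by_contra hpq
  simpa [e] using h.dotProduct_sub_pos hp hq hpq

/-- On a compact set, `K` is expanding with respect to a fixed point. -/
theorem exists_mul_dotProduct_sub_le (h : IsCurvatureMap W K) {Q : Set (ι → ℝ)}
    (hQ : IsCompact Q) (hQW : Q ⊆ W) {p : ι → ℝ} (hp : p ∈ W) :
    ∃ μ > 0, ∀ q ∈ Q, μ * ((q - p) ⬝ᵥ (q - p)) ≤ (K q - K p) ⬝ᵥ (K q - K p) := by
  -- The intermediate point of the mean value theorem need not lie in `Q`. The union of the segments
  -- from `p` to `Q` is still compact in `W`, so one lower bound `m` serves all of them.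
  obtain ⟨m, hm, M, hb⟩ := h.exists_bounds
    (Q := (fun x : ℝ × (ι → ℝ) => p + x.1 • (x.2 - p)) '' (Set.Icc (0 : ℝ) 1 ×ˢ Q))
    ((isCompact_Icc.prod hQ).image (by fun_prop)) (by
      rintro _ ⟨⟨τ, q⟩, ⟨hτ, hq⟩, rfl⟩
      exact h.line_mem hp (hQW hq) hτ)
  refine ⟨m ^ 2, by positivity, fun q hq => ?_⟩
  rcases eq_or_ne p q with rfl | hpq
  · simp
  obtain ⟨τ, hτ, e⟩ := h.exists_dotProduct_sub_eq hp (hQW hq)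
  have h1 := (hb _ ⟨(τ, q), ⟨hτ, hq⟩, rfl⟩ (q - p)).1
  simp only at h1
  rw [← e] at h1
  have h2 := dotProduct_sq_le (q - p) (K p - K q)
  have h3 := dotProduct_self_pos_of_ne_zero (sub_ne_zero.2 hpq.symm)
  have e2 : (K q - K p) ⬝ᵥ (K q - K p) = (K p - K q) ⬝ᵥ (K p - K q) := by
    rw [← neg_sub (K p), neg_dotProduct_neg]
  rw [e2]
  -- Cauchy–Schwarz bounds `(m |q - p|²)²` by `|q - p|² |K p - K q|²`; one factor `|q - p|²` is
  -- cancelled.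
  refine le_of_mul_le_mul_left ?_ h3
  calc (q - p) ⬝ᵥ (q - p) * (m ^ 2 * (q - p) ⬝ᵥ (q - p))
      = (m * (q - p) ⬝ᵥ (q - p)) ^ 2 := by ring
    _ ≤ ((q - p) ⬝ᵥ (K p - K q)) ^ 2 := by gcongr
    _ ≤ _ := h2

/-- Every positive vector is a value of `K`. -/
theorem exists_eq (h : IsCurvatureMap W K) {Kbar : ι → ℝ} (hKbar : ∀ i, 0 < Kbar i) :
    ∃ w ∈ W, K w = Kbar := by
  obtain ⟨w₀, hw₀⟩ := h.nonempty
  -- Logarithms make a bound on `φ` keep every `K w i` away from both `0` and `∞`, which is what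
  -- properness requires.
  set φ : (ι → ℝ) → ℝ := fun w => ∑ i, (Real.log (K w i) - Real.log (Kbar i)) ^ 2 with hφ
  have hd : ∀ w ∈ W, HasFDerivAt φ (∑ i, (2 * (Real.log (K w i) - Real.log (Kbar i))) •
      ((K w i)⁻¹ • (ContinuousLinearMap.proj (R := ℝ) i).comp (fderiv ℝ K w))) w := by
    intro w hw
    refine HasFDerivAt.fun_sum fun i _ => ?_
    have h1 : HasFDerivAt (fun w => K w i)
        ((ContinuousLinearMap.proj (R := ℝ) i).comp (fderiv ℝ K w)) w :=
      hasFDerivAt_pi'.1 (h.hasFDerivAt hw) i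
    have h2 := (h1.log (h.pos w hw i).ne').sub_const (Real.log (Kbar i))
    simpa using h2.pow 2
  obtain ⟨R, hR⟩ : ∃ R, R = φ w₀ := ⟨_, rfl⟩
  have hR0 : 0 ≤ R := hR ▸ Finset.sum_nonneg fun i _ => sq_nonneg _
  obtain ⟨m, hm, hm'⟩ : ∃ m > 0, ∀ i, m ≤ Kbar i := by
    rcases isEmpty_or_nonempty ι with hι | hι
    · exact ⟨1, one_pos, fun i => isEmptyElim i⟩
    · obtain ⟨i, hi⟩ := Finite.exists_min Kbar
      exact ⟨Kbar i, hKbar i, hi⟩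
  obtain ⟨Q, hQW, hQ, hQ'⟩ := h.exists_compact_of_mem_Icc (m * Real.exp (-√R)) (by positivity)
    ((∑ i, Kbar i) * Real.exp √R)
  have hsub : ∀ w ∈ W, φ w ≤ R → w ∈ Q := by
    intro w hw hwR
    refine hQ' w hw fun i => ?_
    have h1 : (Real.log (K w i) - Real.log (Kbar i)) ^ 2 ≤ √R ^ 2 := by
      rw [Real.sq_sqrt hR0]
      exact (Finset.single_le_sum (f := fun i => (Real.log (K w i) - Real.log (Kbar i)) ^ 2)
        (fun i _ => sq_nonneg _) (Finset.mem_univ i)).trans hwR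
    have h2 := abs_le_of_sq_le_sq' h1 (Real.sqrt_nonneg R)
    have hK := h.pos w hw i
    constructor
    · calc m * Real.exp (-√R) ≤ Kbar i * Real.exp (-√R) := by gcongr; exact hm' i
        _ = Real.exp (Real.log (Kbar i) + -√R) := by rw [Real.exp_add, Real.exp_log (hKbar i)]
        _ ≤ Real.exp (Real.log (K w i)) := Real.exp_le_exp.2 (by linarith [h2.1])
        _ = K w i := Real.exp_log hK
    · calc K w i = Real.exp (Real.log (K w i)) := (Real.exp_log hK).symm
        _ ≤ Real.exp (Real.log (Kbar i) + √R) := Real.exp_le_exp.2 (by linarith [h2.2])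
        _ = Kbar i * Real.exp √R := by rw [Real.exp_add, Real.exp_log (hKbar i)]
        _ ≤ _ := by
          gcongr
          exact Finset.single_le_sum (f := Kbar) (fun i _ => (hKbar i).le) (Finset.mem_univ i)
  have hw₀Q : w₀ ∈ Q := hsub w₀ hw₀ hR.ge
  obtain ⟨w, hwQ, hmin⟩ := hQ.exists_isMinOn ⟨w₀, hw₀Q⟩
    (f := φ) fun x hx => (hd x (hQW hx)).continuousAt.continuousWithinAt
  have hw := hQW hwQ
  refine ⟨w, hw, ?_⟩
  -- The minimum over `Q` is a minimum over `W`: points with `φ ≤ R` lie in `Q`, and at the others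
  -- `φ` exceeds its value at `w₀ ∈ Q`.
  have hlocal : IsLocalMin φ w := by
    filter_upwards [h.isOpen.mem_nhds hw] with x hx
    rcases le_total (φ x) R with hxR | hxR
    · exact hmin (hsub x hx hxR)
    · exact (hmin hw₀Q).trans (hR ▸ hxR)
  have hzero := hlocal.hasFDerivAt_eq_zero (hd w hw)
  -- The derivative of `φ` in a direction `v` is `2 u · J v`. Taking `v = u` at the critical point
  -- gives `u · J u = 0`, so `u = 0` by definiteness.
  set u : ι → ℝ := fun i => (Real.log (K w i) - Real.log (Kbar i)) / K w i with hu
  have h1 : u ⬝ᵥ (-jacobian K w) *ᵥ u = 0 := by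
    have := congrArg (fun L : (ι → ℝ) →L[ℝ] ℝ => L u) hzero
    simp only [_root_.sum_apply, _root_.smul_apply,
      ContinuousLinearMap.comp_apply, ContinuousLinearMap.proj_apply, smul_eq_mul,
      _root_.zero_apply] at this
    rw [Matrix.neg_mulVec, dotProduct_neg, jacobian_mulVec, neg_eq_zero]
    refine (mul_right_inj' (two_ne_zero (α := ℝ))).1 ?_
    rw [mul_zero, ← this, dotProduct, Finset.mul_sum]
    refine Finset.sum_congr rfl fun i _ => ?_
    simp only [hu]
    ring
  have hu0 : u = 0 := by
    by_contra hne
    have := (h.posDef w hw).dotProduct_mulVec_pos hne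
    simp only [star_trivial] at this
    exact this.ne' h1
  funext i
  have h2 := congrFun hu0 i
  have hK := h.pos w hw i
  simp only [hu, Pi.zero_apply, div_eq_zero_iff, hK.ne', or_false, sub_eq_zero] at h2
  exact Real.log_injOn_pos hK (hKbar i) h2

end IsCurvatureMap

/-- The dot product as a continuous bilinear form. -/
noncomputable def dotProductCLM (ι : Type*) [Fintype ι] : (ι → ℝ) →L[ℝ] (ι → ℝ) →L[ℝ] ℝ :=
  ∑ i, (ContinuousLinearMap.proj i : (ι → ℝ) →L[ℝ] ℝ).smulRight
    (ContinuousLinearMap.proj i : (ι → ℝ) →L[ℝ] ℝ)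

theorem dotProductCLM_apply {ι : Type*} [Fintype ι] (x y : ι → ℝ) :
    dotProductCLM ι x y = x ⬝ᵥ y := by
  simp [dotProductCLM, dotProduct]

theorem dotProduct_mulVec_comm_of_isHermitian {ι : Type*} [Fintype ι] {A : Matrix ι ι ℝ}
    (hA : A.IsHermitian) (x y : ι → ℝ) : x ⬝ᵥ A *ᵥ y = y ⬝ᵥ A *ᵥ x := by
  rw [Matrix.dotProduct_mulVec, ← Matrix.mulVec_transpose, dotProduct_comm,
    ← Matrix.conjTranspose_eq_transpose_of_trivial, hA.eq]

theorem sq_norm_le_dotProduct_self {ι : Type*} [Fintype ι] (x : ι → ℝ) :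
    ‖x‖ ^ 2 ≤ x ⬝ᵥ x := by
  have h0 : 0 ≤ x ⬝ᵥ x := Finset.sum_nonneg fun i _ => mul_self_nonneg (x i)
  rw [← Real.sq_sqrt h0]
  refine pow_le_pow_left₀ (norm_nonneg _) ((pi_norm_le_iff_of_nonneg (Real.sqrt_nonneg _)).2
    fun i => Real.le_sqrt_of_sq_le ?_) 2
  rw [Real.norm_eq_abs, sq_abs, sq]
  exact Finset.single_le_sum (f := fun i => x i * x i) (fun i _ => mul_self_nonneg _)
    (Finset.mem_univ i)

/-! ### The convex potential, the invariant sets and the flow of a curvature map -/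

namespace IsCurvatureMap

variable {ι : Type*} [Fintype ι] [DecidableEq ι] {W : Set (ι → ℝ)} {K : (ι → ℝ) → ι → ℝ}

/-- The closed one-form `∑ (K̄ᵢ - Kᵢ) dwᵢ` has a primitive. -/
theorem exists_potential (h : IsCurvatureMap W K) (Kbar : ι → ℝ) :
    ∃ E : (ι → ℝ) → ℝ, ∀ w ∈ W, HasFDerivAt E (dotProductCLM ι (Kbar - K w)) w := by
  have hd : ∀ w ∈ W, HasFDerivAt (fun w => dotProductCLM ι (Kbar - K w))
      ((dotProductCLM ι).comp (-fderiv ℝ K w)) w := fun w hw =>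
    (dotProductCLM ι).hasFDerivAt.comp w ((h.hasFDerivAt hw).const_sub Kbar)
  -- Poincaré lemma on a convex domain; closedness of the form is the symmetry of the Jacobian.
  refine h.convex.exists_forall_hasFDerivAt_of_fderiv_symmetric h.isOpen
    (fun w hw => (hd w hw).differentiableAt.differentiableWithinAt) fun w hw x y => ?_
  have e := dotProduct_mulVec_comm_of_isHermitian (h.posDef w hw).isHermitian x y
  rw [(hd w hw).fderiv]
  simp only [ContinuousLinearMap.comp_apply, dotProductCLM_apply, neg_apply, ← jacobian_mulVec,
    ← Matrix.neg_mulVec]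
  rw [dotProduct_comm, ← e, dotProduct_comm]

/-- The potential lies above its tangent planes. -/
theorem add_dotProduct_le_potential (h : IsCurvatureMap W K) {Kbar : ι → ℝ} {E : (ι → ℝ) → ℝ}
    (hE : ∀ w ∈ W, HasFDerivAt E (dotProductCLM ι (Kbar - K w)) w) {p q : ι → ℝ} (hp : p ∈ W)
    (hq : q ∈ W) : E p + (Kbar - K p) ⬝ᵥ (q - p) ≤ E q := by
  have hd : ∀ τ ∈ Set.Icc (0 : ℝ) 1, HasDerivAt (fun τ : ℝ => E (p + τ • (q - p)))
      ((Kbar - K (p + τ • (q - p))) ⬝ᵥ (q - p)) τ := by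
    intro τ hτ
    rw [← dotProductCLM_apply]
    exact (hE _ (h.line_mem hp hq hτ)).comp_hasDerivAt τ (hasDerivAt_add_smul p (q - p) τ)
  obtain ⟨τ, hτ, e⟩ := exists_hasDerivAt_eq_slope _ _ zero_lt_one
    (fun τ hτ => (hd τ hτ).continuousAt.continuousWithinAt)
    (fun τ hτ => hd τ (Set.Ioo_subset_Icc_self hτ))
  simp only [one_smul, add_sub_cancel, zero_smul, add_zero, sub_zero, div_one] at e
  have hmem := h.line_mem hp hq (Set.Ioo_subset_Icc_self hτ)
  -- The mean value theorem produces the gradient at an intermediate point; monotonicity of `-K`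
  -- compares it with the gradient at `p`.
  have hmono : 0 ≤ (q - p) ⬝ᵥ (K p - K (p + τ • (q - p))) := by
    rcases eq_or_ne p (p + τ • (q - p)) with h' | h'
    · rw [← h']; simp
    · have := h.dotProduct_sub_pos hp hmem h'
      rw [add_sub_cancel_left, smul_dotProduct, smul_eq_mul] at this
      exact (pos_of_mul_pos_right this hτ.1.le).le
  rw [dotProduct_comm] at hmono
  have e2 : (Kbar - K (p + τ • (q - p))) ⬝ᵥ (q - p) = (Kbar - K p) ⬝ᵥ (q - p)
      + (K p - K (p + τ • (q - p))) ⬝ᵥ (q - p) := by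
    rw [← add_dotProduct]; congr 1; abel
  linarith

/-- Sublevel sets of the potential are bounded. -/
theorem exists_norm_le_of_potential_le (h : IsCurvatureMap W K) {Kbar : ι → ℝ}
    {E : (ι → ℝ) → ℝ} (hE : ∀ w ∈ W, HasFDerivAt E (dotProductCLM ι (Kbar - K w)) w)
    {wbar : ι → ℝ} (hwbar : wbar ∈ W) (hK : K wbar = Kbar) (E₀ : ℝ) :
    ∃ R, ∀ w ∈ W, E w ≤ E₀ → ‖w‖ ≤ R := by
  obtain ⟨r, hr, hrW⟩ := Metric.nhds_basis_closedBall.mem_iff.1 (h.isOpen.mem_nhds hwbar)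
  have hS : Metric.sphere wbar r ⊆ W := Metric.sphere_subset_closedBall.trans hrW
  -- On a small sphere around the critical point `wbar` the potential increases outwards, uniformly
  -- by compactness.
  obtain ⟨η, hη, hη'⟩ := (isCompact_sphere wbar r).exists_forall_le' (a := 0)
    (f := fun p => (p - wbar) ⬝ᵥ (Kbar - K p))
    (by
      have := h.continuousOn.mono hS
      have h2 : Continuous fun x : (ι → ℝ) × (ι → ℝ) => (x.1 - wbar) ⬝ᵥ (Kbar - x.2) := by
        fun_prop
      exact h2.comp_continuousOn (continuousOn_id.prodMk this))
    (fun p hp => by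
      rw [← hK]
      refine h.dotProduct_sub_pos hwbar (hS hp) ?_
      rintro rfl
      simp [hr.ne] at hp)
  refine ⟨‖wbar‖ + (r + r * |E₀ - E wbar| / η), fun w hw hwE => ?_⟩
  have hρ : ‖w - wbar‖ ≤ r + r * |E₀ - E wbar| / η := by
    rcases le_or_gt ‖w - wbar‖ r with hle | hlt
    · exact hle.trans (le_add_of_nonneg_right (by positivity))
    have hρ0 : 0 < ‖w - wbar‖ := hr.trans hlt
    set ρ := ‖w - wbar‖ with hρ_def
    -- `p` is the point where the segment from `wbar` to `w` crosses the sphere. The tangent plane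
    -- at `p` lies below the potential, which therefore grows at least linearly in `ρ` beyond `p`.
    obtain ⟨p, hp⟩ : ∃ p, p = wbar + (r / ρ) • (w - wbar) := ⟨_, rfl⟩
    have hpS : p ∈ Metric.sphere wbar r := by
      rw [mem_sphere_iff_norm, hp, add_sub_cancel_left, norm_smul, ← hρ_def, Real.norm_eq_abs,
        abs_of_pos (by positivity)]
      field_simp
    have e1 : p - wbar = (r / ρ) • (w - wbar) := by rw [hp, add_sub_cancel_left]
    have e2 : w - p = ((ρ - r) / r) • (p - wbar) := by
      have : w - p = (1 - r / ρ) • (w - wbar) := by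
        rw [sub_smul, one_smul, ← e1]; abel
      rw [this, e1, smul_smul]
      congr 1
      field_simp
    have h1 := h.add_dotProduct_le_potential hE hwbar (hS hpS)
    have h2 := h.add_dotProduct_le_potential hE (hS hpS) hw
    have h3 := hη' p hpS
    rw [hK, sub_self, zero_dotProduct, add_zero] at h1
    rw [e2, dotProduct_smul, dotProduct_comm, smul_eq_mul] at h2
    have h4 : (ρ - r) / r * η ≤ |E₀ - E wbar| := by
      calc (ρ - r) / r * η ≤ (ρ - r) / r * ((p - wbar) ⬝ᵥ (Kbar - K p)) := by
            have : 0 ≤ ρ - r := by linarith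
            gcongr
        _ ≤ E₀ - E wbar := by linarith
        _ ≤ _ := le_abs_self _
    have h5 : ρ - r ≤ r * |E₀ - E wbar| / η := by
      rw [le_div_iff₀ hη]
      calc (ρ - r) * η = r * ((ρ - r) / r * η) := by field_simp
        _ ≤ _ := by gcongr
    linarith
  calc ‖w‖ = ‖wbar + (w - wbar)‖ := by rw [add_sub_cancel]
    _ ≤ _ := (norm_add_le _ _).trans (by gcongr)

/-- The squared distance of `K` to the target. -/
def energy (K : (ι → ℝ) → ι → ℝ) (Kbar w : ι → ℝ) : ℝ :=
  (K w - Kbar) ⬝ᵥ (K w - Kbar)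

/-- Along the flow `(K - K̄)' = J (-J)^s (K - K̄) = -(-J)(-J)^s (K - K̄)`, so the dissipation is the
form of `(-J)^(1+s)`. -/
theorem hasDerivWithinAt_energy (h : IsCurvatureMap W K) {Kbar : ι → ℝ} {s : ℝ}
    {γ : ℝ → ι → ℝ} {I : Set ℝ} {t : ℝ} (hγ : γ t ∈ W)
    (hd : HasDerivWithinAt γ (fractionalField K Kbar s (γ t)) I t) :
    HasDerivWithinAt (fun t => energy K Kbar (γ t))
      (-(2 * ((K (γ t) - Kbar) ⬝ᵥ (-jacobian K (γ t) *
        matrixRpow (-jacobian K (γ t)) s) *ᵥ (K (γ t) - Kbar)))) I t := by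
  have h1 : HasDerivWithinAt (fun t => K (γ t) - Kbar)
      (fderiv ℝ K (γ t) (fractionalField K Kbar s (γ t))) I t :=
    ((h.hasFDerivAt hγ).comp_hasDerivWithinAt t hd).sub_const Kbar
  have e : fderiv ℝ K (γ t) (fractionalField K Kbar s (γ t)) = -((-jacobian K (γ t) *
        matrixRpow (-jacobian K (γ t)) s) *ᵥ (K (γ t) - Kbar)) := by
    rw [← jacobian_mulVec, fractionalField_eq, ← Matrix.mulVec_mulVec, Matrix.neg_mulVec, neg_neg]
  rw [e] at h1
  have h2 : HasDerivWithinAt (fun t => energy K Kbar (γ t)) _ I t :=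
    HasDerivWithinAt.fun_sum (u := Finset.univ) fun i _ =>
      (hasDerivWithinAt_pi.1 h1 i).mul (hasDerivWithinAt_pi.1 h1 i)
  convert h2 using 1
  rw [dotProduct, Finset.mul_sum, ← Finset.sum_neg_distrib]
  refine Finset.sum_congr rfl fun i _ => ?_
  simp only [Pi.neg_apply]
  ring

/-- The gradient `K̄ - K` paired with the velocity `(-J)^s (K - K̄)` is minus the form of `(-J)^s`.
-/
theorem hasDerivWithinAt_potential {Kbar : ι → ℝ} {E : (ι → ℝ) → ℝ}
    (hE : ∀ w ∈ W, HasFDerivAt E (dotProductCLM ι (Kbar - K w)) w) {s : ℝ}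
    {γ : ℝ → ι → ℝ} {I : Set ℝ} {t : ℝ} (hγ : γ t ∈ W)
    (hd : HasDerivWithinAt γ (fractionalField K Kbar s (γ t)) I t) :
    HasDerivWithinAt (fun t => E (γ t))
      (-((K (γ t) - Kbar) ⬝ᵥ matrixRpow (-jacobian K (γ t)) s *ᵥ (K (γ t) - Kbar))) I t := by
  have h1 := (hE _ hγ).comp_hasDerivWithinAt t hd
  rw [dotProductCLM_apply, fractionalField_eq, ← neg_sub (K (γ t)), neg_dotProduct] at h1
  exact h1

theorem antitoneOn_of_hasDerivWithinAt_Icc {f f' : ℝ → ℝ} {a b : ℝ}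
    (hf : ∀ t ∈ Set.Icc a b, HasDerivWithinAt f (f' t) (Set.Icc a b) t)
    (hf' : ∀ t ∈ Set.Icc a b, f' t ≤ 0) : AntitoneOn f (Set.Icc a b) :=
  antitoneOn_of_hasDerivWithinAt_nonpos (convex_Icc a b)
    (fun t ht => (hf t ht).continuousWithinAt)
    (fun t ht => (hf t (interior_subset ht)).mono interior_subset)
    fun t ht => hf' t (interior_subset ht)

theorem le_dotProduct_of_mem (h : IsCurvatureMap W K) {Q : Set (ι → ℝ)} (hQ : IsCompact Q)
    (hQW : Q ⊆ W) (s : ℝ) : ∃ μ > 0, ∀ w ∈ Q, ∀ x : ι → ℝ,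
      μ * (x ⬝ᵥ x) ≤ x ⬝ᵥ matrixRpow (-jacobian K w) s *ᵥ x ∧
      μ * (x ⬝ᵥ x) ≤ x ⬝ᵥ (-jacobian K w * matrixRpow (-jacobian K w) s) *ᵥ x := by
  obtain ⟨m, hm, M, hb⟩ := h.exists_bounds hQ hQW
  -- `M` is not known to be positive; the larger bound `max M m` is, so its power `s` is positive
  -- too.
  have hM : 0 < max M m := lt_max_of_lt_right hm
  have hl : 0 < min (m ^ s) (max M m ^ s) := by positivity
  refine ⟨min (min (m ^ s) (max M m ^ s)) (m * min (m ^ s) (max M m ^ s)), by positivity,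
    fun w hw x => ?_⟩
  have hx : 0 ≤ x ⬝ᵥ x := (sq_nonneg _).trans (sq_norm_le_dotProduct_self x)
  have hA := (h.posDef w (hQW hw)).isHermitian
  have hb2 : ∀ x, x ⬝ᵥ (-jacobian K w) *ᵥ x ≤ max M m * (x ⬝ᵥ x) := fun x =>
    (hb w hw x).2.trans (mul_le_mul_of_nonneg_right (le_max_left _ _)
      ((sq_nonneg _).trans (sq_norm_le_dotProduct_self x)))
  refine ⟨(mul_le_mul_of_nonneg_right (min_le_left _ _) hx).trans
      (le_dotProduct_matrixRpow_mulVec hA hm (fun x => (hb w hw x).1) hb2 s x),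
    (mul_le_mul_of_nonneg_right (min_le_right _ _) hx).trans
      (le_dotProduct_mul_matrixRpow_mulVec hA hm (fun x => (hb w hw x).1) hb2 s x)⟩

theorem dotProduct_nonneg_of_mem (h : IsCurvatureMap W K) {w : ι → ℝ} (hw : w ∈ W) (s : ℝ)
    (x : ι → ℝ) : 0 ≤ x ⬝ᵥ matrixRpow (-jacobian K w) s *ᵥ x ∧
      0 ≤ x ⬝ᵥ (-jacobian K w * matrixRpow (-jacobian K w) s) *ᵥ x := by
  obtain ⟨μ, hμ, hb⟩ := h.le_dotProduct_of_mem isCompact_singleton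
    (Set.singleton_subset_iff.2 hw) s
  have hx : 0 ≤ μ * (x ⬝ᵥ x) :=
    mul_nonneg hμ.le ((sq_nonneg _).trans (sq_norm_le_dotProduct_self x))
  exact ⟨hx.trans (hb w rfl x).1, hx.trans (hb w rfl x).2⟩

/-- Every point of the domain lies in a compact set which is invariant under the flow. -/
theorem exists_invariant (h : IsCurvatureMap W K) {Kbar : ι → ℝ} (hKbar : ∀ i, 0 < Kbar i)
    (s : ℝ) {w₀ : ι → ℝ} (hw₀ : w₀ ∈ W) : ∃ Q ⊆ W, IsCompact Q ∧ w₀ ∈ Q ∧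
      IsCurveInvariant (fractionalField K Kbar s) W Q := by
  obtain ⟨wbar, hwbar, hK⟩ := h.exists_eq hKbar
  obtain ⟨E, hE⟩ := h.exists_potential Kbar
  obtain ⟨R, hR⟩ := h.exists_norm_le_of_potential_le hE hwbar hK (E w₀)
  -- The energy bounds `K w i` by `Kbar i + √(energy at w₀)`, and the sum of `Kbar` dominates each
  -- entry. The radius `R` comes from the potential.
  obtain ⟨Q, hQW, hQ, hQ'⟩ := h.exists_compact_of_le
    (∑ i, Kbar i + √(energy K Kbar w₀)) R
  have hcE : ContinuousOn E Q := fun w hw =>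
    (hE w (hQW hw)).continuousAt.continuousWithinAt
  have hcV : ContinuousOn (energy K Kbar) Q := by
    have h1 : Continuous fun x : ι → ℝ => (x - Kbar) ⬝ᵥ (x - Kbar) := by fun_prop
    exact h1.comp_continuousOn (h.continuousOn.mono hQW)
  have hclosed : IsClosed ((Q ∩ E ⁻¹' Set.Iic (E w₀)) ∩
      (Q ∩ energy K Kbar ⁻¹' Set.Iic (energy K Kbar w₀))) :=
    (hcE.preimage_isClosed_of_isClosed hQ.isClosed isClosed_Iic).inter
      (hcV.preimage_isClosed_of_isClosed hQ.isClosed isClosed_Iic)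
  have hmem : ∀ w ∈ W, E w ≤ E w₀ → energy K Kbar w ≤ energy K Kbar w₀ → w ∈ Q := by
    intro w hw h1 h2
    refine hQ' w hw (fun i => ?_) (hR w hw h1)
    have h3 : K w i - Kbar i ≤ √(energy K Kbar w₀) := by
      refine Real.le_sqrt_of_sq_le (le_trans ?_ h2)
      rw [sq]
      exact Finset.single_le_sum (f := fun i => (K w - Kbar) i * (K w - Kbar) i)
        (fun i _ => mul_self_nonneg _) (Finset.mem_univ i)
    have h4 := Finset.single_le_sum (f := Kbar) (fun i _ => (hKbar i).le) (Finset.mem_univ i)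
    linarith
  -- The invariant set is the common sublevel set of the potential and the energy through `w₀`; both
  -- functions decrease along curves in `W`.
  refine ⟨_, fun w hw => hQW hw.1.1, hQ.of_isClosed_subset hclosed fun w hw => hw.1.1,
    ⟨⟨hmem w₀ hw₀ le_rfl le_rfl, le_refl (E w₀)⟩,
      ⟨hmem w₀ hw₀ le_rfl le_rfl, le_refl (energy K Kbar w₀)⟩⟩, ?_⟩
  rintro γ a b hab hγ ⟨⟨-, ha1⟩, ⟨-, ha2⟩⟩
  have hbI : b ∈ Set.Icc a b := Set.right_mem_Icc.2 hab
  have haI : a ∈ Set.Icc a b := Set.left_mem_Icc.2 hab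
  have h1 : E (γ b) ≤ E w₀ := (antitoneOn_of_hasDerivWithinAt_Icc
    (fun t ht => hasDerivWithinAt_potential hE (hγ t ht).1 (hγ t ht).2)
    (fun t ht => neg_nonpos.2 (h.dotProduct_nonneg_of_mem (hγ t ht).1 s _).1)
    haI hbI hab).trans ha1
  have h2 : energy K Kbar (γ b) ≤ energy K Kbar w₀ := (antitoneOn_of_hasDerivWithinAt_Icc
    (fun t ht => h.hasDerivWithinAt_energy (hγ t ht).1 (hγ t ht).2)
    (fun t ht => neg_nonpos.2 (mul_nonneg zero_le_two
      (h.dotProduct_nonneg_of_mem (hγ t ht).1 s _).2))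
    haI hbI hab).trans ha2
  have h3 := hmem _ (hγ b hbI).1 h1 h2
  exact ⟨⟨h3, h1⟩, ⟨h3, h2⟩⟩

/-- Exponential decay along curves which stay in a compact set. -/
theorem exists_norm_sub_le (h : IsCurvatureMap W K) {Kbar : ι → ℝ} {wbar : ι → ℝ}
    (hwbar : wbar ∈ W) (hK : K wbar = Kbar) (s : ℝ) {Q : Set (ι → ℝ)} (hQ : IsCompact Q)
    (hQW : Q ⊆ W) {γ : ℝ → ι → ℝ} (hγQ : ∀ t ≥ 0, γ t ∈ Q)
    (hγ : ∀ T, IsCurveOn (fractionalField K Kbar s) W γ 0 T) :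
    ∃ C > 0, ∃ c > 0, ∀ t ≥ 0, ‖γ t - wbar‖ ≤ C * Real.exp (-c * t) := by
  obtain ⟨c, hc, hc'⟩ := h.le_dotProduct_of_mem hQ hQW s
  obtain ⟨μ, hμ, hμ'⟩ := h.exists_mul_dotProduct_sub_le hQ hQW hwbar
  have hV0 : 0 ≤ energy K Kbar (γ 0) := (sq_nonneg _).trans (sq_norm_le_dotProduct_self _)
  have hdecay : ∀ t ≥ 0, energy K Kbar (γ t) ≤ energy K Kbar (γ 0) * Real.exp (-(2 * c) * t) := by
    intro t ht
    -- Grönwall's argument: since the energy `V` satisfies `V' ≤ -2cV`, the product `V * exp (2 c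
    -- r)` is nonincreasing.
    have hd : ∀ r ∈ Set.Icc 0 t, HasDerivWithinAt
        (fun r => energy K Kbar (γ r) * Real.exp (2 * c * r)) _ (Set.Icc 0 t) r := fun r hr =>
      (h.hasDerivWithinAt_energy (hγ t r hr).1 (hγ t r hr).2).mul
        (((hasDerivAt_id r).const_mul (2 * c)).exp.hasDerivWithinAt)
    have hanti := antitoneOn_of_hasDerivWithinAt_Icc hd (fun r hr => by
      have h1 := (hc' _ (hγQ r hr.1) (K (γ r) - Kbar)).2
      have h2 := Real.exp_pos (2 * c * r)
      have h3 : c * energy K Kbar (γ r) ≤ _ := h1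
      simp only [id, mul_one]
      nlinarith) (Set.left_mem_Icc.2 ht) (Set.right_mem_Icc.2 ht) ht
    simp only [mul_zero, Real.exp_zero, mul_one] at hanti
    rw [neg_mul, Real.exp_neg, ← div_eq_mul_inv, le_div_iff₀ (Real.exp_pos _)]
    exact hanti
  -- The summand `1` only makes the constant positive when the energy starts at zero. The rate is
  -- `c` rather than `2 * c` since the energy controls the squared distance.
  refine ⟨√(energy K Kbar (γ 0) / μ) + 1, by positivity, c, hc, fun t ht => ?_⟩
  have h1 : ‖γ t - wbar‖ ^ 2 ≤ (√(energy K Kbar (γ 0) / μ) * Real.exp (-c * t)) ^ 2 := by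
    refine (sq_norm_le_dotProduct_self _).trans ?_
    have h2 := hμ' _ (hγQ t ht)
    rw [hK] at h2
    have h3 := h2.trans (hdecay t ht)
    rw [mul_pow, Real.sq_sqrt (by positivity), ← Real.exp_nat_mul, div_mul_eq_mul_div,
      le_div_iff₀ hμ, mul_comm]
    convert h3 using 3
    push_cast; ring
  refine (le_of_sq_le_sq h1 (by positivity)).trans ?_
  gcongr
  linarith

theorem exists_flow (h : IsCurvatureMap W K) {Kbar : ι → ℝ} (hKbar : ∀ i, 0 < Kbar i)
    {wbar : ι → ℝ} (hwbar : wbar ∈ W) (hK : K wbar = Kbar) (s : ℝ) {w₀ : ι → ℝ} (hw₀ : w₀ ∈ W) :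
    ∃ w : ℝ → ι → ℝ, w 0 = w₀ ∧ (∀ t ≥ 0, w t ∈ W) ∧
      (∀ t ≥ 0, HasDerivWithinAt w (fractionalField K Kbar s (w t)) (Set.Ici 0) t) ∧
      (∀ (T : ℝ) (v : ℝ → ι → ℝ), v 0 = w₀ → IsCurveOn (fractionalField K Kbar s) W v 0 T →
        ∀ t ∈ Set.Icc 0 T, v t = w t) ∧
      ∃ C > 0, ∃ c > 0, ∀ t ≥ 0, ‖w t - wbar‖ ≤ C * Real.exp (-c * t) := by
  obtain ⟨Q, hQW, hQ, hw₀Q, hinv⟩ := h.exists_invariant hKbar s hw₀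
  have hf := h.locallyLipschitzOn_fractionalField Kbar s
  obtain ⟨w, h0, hwQ, hd, hcurve⟩ := exists_global_curve h.isOpen hf hQ hQW hinv hw₀Q
  refine ⟨w, h0, fun t ht => hQW (hwQ t ht), hd, fun T v hv0 hv => ?_,
    h.exists_norm_sub_le hwbar hK s hQ hQW hwQ hcurve⟩
  exact hv.eqOn hf hQ hQW hinv (hcurve T) (hv0 ▸ hw₀Q) (hv0.trans h0.symm)

end IsCurvatureMap

/-! ### The hexagon -/

/-- The length of the black side of a right-angled hexagon, as a function of the hyperbolic
cosines of the lengths of the opposite and of the adjacent red sides. -/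
noncomputable def cornerLength (a b c : ℝ) : ℝ :=
  Real.arcosh ((b * c + a) / √((b ^ 2 - 1) * (c ^ 2 - 1)))

/-- The square of the product of the hyperbolic sines of a black side and its adjacent
red sides. -/
def hexagonGram (a b c : ℝ) : ℝ := a ^ 2 + b ^ 2 + c ^ 2 + 2 * a * b * c - 1

theorem hexagonGram_pos {a b c : ℝ} (ha : 1 < a) (hb : 1 < b) (hc : 1 < c) :
    0 < hexagonGram a b c := by
  have : 0 < 2 * a * b * c := by positivity
  simp only [hexagonGram]
  nlinarith

theorem sq_sub_one_pos {b : ℝ} (hb : 1 < b) : 0 < b ^ 2 - 1 := by nlinarith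

/-- The difference `(bc + a)² - (b² - 1)(c² - 1)` is `hexagonGram a b c`. -/
theorem one_lt_cosh_cornerLength {a b c : ℝ} (ha : 1 < a) (hb : 1 < b) (hc : 1 < c) :
    1 < (b * c + a) / √((b ^ 2 - 1) * (c ^ 2 - 1)) := by
  have hb' := sq_sub_one_pos hb
  have hc' := sq_sub_one_pos hc
  rw [one_lt_div (by positivity), Real.sqrt_lt' (by positivity)]
  have := hexagonGram_pos ha hb hc
  simp only [hexagonGram] at this
  linarith

theorem cosh_cornerLength {a b c : ℝ} (ha : 1 < a) (hb : 1 < b) (hc : 1 < c) :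
    Real.cosh (cornerLength a b c) = (b * c + a) / √((b ^ 2 - 1) * (c ^ 2 - 1)) :=
  Real.cosh_arcosh (one_lt_cosh_cornerLength ha hb hc).le

theorem cornerLength_pos {a b c : ℝ} (ha : 1 < a) (hb : 1 < b) (hc : 1 < c) :
    0 < cornerLength a b c :=
  Real.arcosh_pos (one_lt_cosh_cornerLength ha hb hc)

theorem arcLength_eq_cornerLength {x y z : ℝ} (hx : 0 < x) (hy : 0 < y) (hz : 0 < z) :
    arcLength x y z = cornerLength (Real.cosh x) (Real.cosh y) (Real.cosh z) := by
  have sy := Real.sinh_pos_iff.2 hy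
  have sz := Real.sinh_pos_iff.2 hz
  rw [arcLength_eq hx hy hz, cornerLength, Real.cosh_sq y, Real.cosh_sq z, add_sub_cancel_right,
    add_sub_cancel_right, ← mul_pow, Real.sqrt_sq (by positivity)]

theorem ContDiffOn.cornerLength {E : Type*} [NormedAddCommGroup E] [NormedSpace ℝ E] {s : Set E}
    {n : WithTop ℕ∞} {a b c : E → ℝ} (ha : ContDiffOn ℝ n a s) (hb : ContDiffOn ℝ n b s)
    (hc : ContDiffOn ℝ n c s) (ha1 : ∀ x ∈ s, 1 < a x) (hb1 : ∀ x ∈ s, 1 < b x)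
    (hc1 : ∀ x ∈ s, 1 < c x) : ContDiffOn ℝ n (fun x => cornerLength (a x) (b x) (c x)) s := by
  have hD : ∀ x ∈ s, 0 < (b x ^ 2 - 1) * (c x ^ 2 - 1) := fun x hx =>
    mul_pos (sq_sub_one_pos (hb1 x hx)) (sq_sub_one_pos (hc1 x hx))
  have h1 : ContDiffOn ℝ n (fun x => (b x * c x + a x) /
      √((b x ^ 2 - 1) * (c x ^ 2 - 1))) s :=
    ((hb.mul hc).add ha).div ((((hb.pow 2).sub contDiffOn_const).mul
      ((hc.pow 2).sub contDiffOn_const)).sqrt fun x hx => (hD x hx).ne')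
      fun x hx => (Real.sqrt_pos.2 (hD x hx)).ne'
  intro x hx
  exact (Real.contDiffAt_arcosh (one_lt_cosh_cornerLength (ha1 x hx) (hb1 x hx)
    (hc1 x hx))).comp_contDiffWithinAt x (h1 x hx)

/-- The derivative cosine law. -/
theorem HasDerivAt.cornerLength {a b c : ℝ → ℝ} {a' b' c' t : ℝ} (ha : HasDerivAt a a' t)
    (hb : HasDerivAt b b' t) (hc : HasDerivAt c c' t) (ha1 : 1 < a t) (hb1 : 1 < b t)
    (hc1 : 1 < c t) : HasDerivAt (fun t => cornerLength (a t) (b t) (c t))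
      ((√(hexagonGram (a t) (b t) (c t)))⁻¹ * (a' - (a t * b t + c t) / (b t ^ 2 - 1) * b'
        - (a t * c t + b t) / (c t ^ 2 - 1) * c')) t := by
  have hb2 := sq_sub_one_pos hb1
  have hc2 := sq_sub_one_pos hc1
  have hD : 0 < (b t ^ 2 - 1) * (c t ^ 2 - 1) := mul_pos hb2 hc2
  have h1 := ((hb.mul hc).add ha).div ((((hb.pow 2).sub_const 1).mul
    ((hc.pow 2).sub_const 1)).sqrt hD.ne') (Real.sqrt_pos.2 hD).ne'
  have h2 := (Real.hasDerivAt_arcosh (one_lt_cosh_cornerLength ha1 hb1 hc1)).comp t h1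
  refine h2.congr_deriv ?_
  have hG := hexagonGram_pos ha1 hb1 hc1
  -- This is the hyperbolic sine of the black side; the square root of the Gram expression is
  -- symmetric in the three red sides.
  have e : √(((b t * c t + a t) / √((b t ^ 2 - 1) * (c t ^ 2 - 1))) ^ 2 - 1) =
      √(hexagonGram (a t) (b t) (c t)) / √((b t ^ 2 - 1) * (c t ^ 2 - 1)) := by
    rw [← Real.sqrt_div hG.le, div_pow, Real.sq_sqrt hD.le]
    congr 1
    rw [eq_div_iff hD.ne', sub_mul, div_mul_cancel₀ _ hD.ne', hexagonGram]
    ring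
  simp only [Pi.add_apply, Pi.mul_apply, Pi.pow_apply]
  rw [e]
  have hr := Real.sqrt_pos.2 hD
  have hr2 := Real.sq_sqrt hD.le
  have hg := Real.sqrt_pos.2 hG
  generalize √(hexagonGram (a t) (b t) (c t)) = g at *
  generalize √((b t ^ 2 - 1) * (c t ^ 2 - 1)) = r at *
  rw [inv_div, div_mul_eq_mul_div, inv_mul_eq_div]
  congr 1
  field_simp
  rw [hr2]
  field_simp
  ring

/-- Minus the logarithmic variation of the length of a black side, up to the factor
`2 / √(hexagonGram a b c)`, under vertex scaling by `u` at this side and by `v`, `w` at the other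
two black sides, where `v` is opposite to the red side with hyperbolic cosine `b`. -/
noncomputable def cornerVariation (a b c u v w : ℝ) : ℝ :=
  (a * b + c) / (b - 1) * (w + u) + (a * c + b) / (c - 1) * (u + v) - (a + 1) * (v + w)

/-- The quadratic form of a hexagon. -/
noncomputable def hexagonForm (c u v : Fin 3 → ℝ) : ℝ :=
  ∑ k, u k * cornerVariation (c k) (c (k + 1)) (c (k + 2)) (v k) (v (k + 1)) (v (k + 2))

/-- The coefficient of `u 0 * v 1` is `(c 0 + c 1) / (c 2 - 1) - 1`, which is symmetric in `0` and
`1`; the other pairs follow cyclically. -/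
theorem hexagonForm_comm {c : Fin 3 → ℝ} (hc : ∀ k, 1 < c k) (u v : Fin 3 → ℝ) :
    hexagonForm c u v = hexagonForm c v u := by
  have h0 : c 0 - 1 ≠ 0 := by linarith [hc 0]
  have h1 : c 1 - 1 ≠ 0 := by linarith [hc 1]
  have h2 : c 2 - 1 ≠ 0 := by linarith [hc 2]
  simp only [hexagonForm, Fin.sum_univ_three, cornerVariation, Fin.reduceAdd, zero_add]
  field_simp
  ring

/-- The form is a sum of squares with positive coefficients. Its diagonal part, with weights `c i -
1`, alone makes it strictly positive. -/
theorem hexagonForm_self_pos {c : Fin 3 → ℝ} (hc : ∀ k, 1 < c k) {v : Fin 3 → ℝ} (hv : v ≠ 0) :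
    0 < hexagonForm c v v := by
  have h0 : 0 < c 0 - 1 := by linarith [hc 0]
  have h1 : 0 < c 1 - 1 := by linarith [hc 1]
  have h2 : 0 < c 2 - 1 := by linarith [hc 2]
  have e : hexagonForm c v v = (v 0 - v 1) ^ 2 + (v 1 - v 2) ^ 2 + (v 2 - v 0) ^ 2
      + (c 1 + c 2) / (c 0 - 1) * (v 1 + v 2) ^ 2 + (c 2 + c 0) / (c 1 - 1) * (v 2 + v 0) ^ 2
      + (c 0 + c 1) / (c 2 - 1) * (v 0 + v 1) ^ 2
      + 2 * ((c 0 - 1) * v 0 ^ 2 + (c 1 - 1) * v 1 ^ 2 + (c 2 - 1) * v 2 ^ 2) := by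
    simp only [hexagonForm, Fin.sum_univ_three, cornerVariation, Fin.reduceAdd, zero_add]
    field_simp
    ring
  have hs : 0 < (c 0 - 1) * v 0 ^ 2 + (c 1 - 1) * v 1 ^ 2 + (c 2 - 1) * v 2 ^ 2 := by
    obtain ⟨k, hk⟩ := Function.ne_iff.1 hv
    have hk : 0 < v k ^ 2 := by
      have : v k ≠ 0 := hk
      positivity
    have e : ∑ i, (c i - 1) * v i ^ 2 =
        (c 0 - 1) * v 0 ^ 2 + (c 1 - 1) * v 1 ^ 2 + (c 2 - 1) * v 2 ^ 2 :=
      Fin.sum_univ_three _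
    rw [← e]
    exact Finset.sum_pos' (fun i _ => mul_nonneg (by linarith [hc i]) (sq_nonneg _))
      ⟨k, Finset.mem_univ k, mul_pos (by linarith [hc k]) hk⟩
  have p0 : 0 < (c 1 + c 2) / (c 0 - 1) := div_pos (by linarith) h0
  have p1 : 0 < (c 2 + c 0) / (c 1 - 1) := div_pos (by linarith) h1
  have p2 : 0 < (c 0 + c 1) / (c 2 - 1) := div_pos (by linarith) h2
  rw [e]
  positivity

/-! ### A priori estimates for the hexagon -/

/-- The left side is the hyperbolic cotangent of an adjacent red side: drop `a` and use `√(c² - 1) ≤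
c`. A collapsing red side thus makes the adjacent black sides infinitely long. -/
theorem div_sqrt_le_cosh_cornerLength {a b c : ℝ} (ha : 1 < a) (hb : 1 < b) (hc : 1 < c) :
    b / √(b ^ 2 - 1) ≤ Real.cosh (cornerLength a b c) := by
  have hb2 := Real.sqrt_pos.2 (sq_sub_one_pos hb)
  have hc2 := Real.sqrt_pos.2 (sq_sub_one_pos hc)
  rw [cosh_cornerLength ha hb hc, Real.sqrt_mul (sq_sub_one_pos hb).le,
    div_le_div_iff₀ hb2 (by positivity)]
  have h1 : √(c ^ 2 - 1) ≤ c := Real.sqrt_le_iff.2 ⟨by linarith, by linarith⟩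
  calc b * (√(b ^ 2 - 1) * √(c ^ 2 - 1)) ≤ b * (√(b ^ 2 - 1) * c) := by gcongr
    _ ≤ (b * c + a) * √(b ^ 2 - 1) := by nlinarith

/-- An upper bound of a black side gives a lower bound of the adjacent red sides. -/
theorem le_sq_of_cornerLength_le {a b c M : ℝ} (ha : 1 < a) (hb : 1 < b) (hc : 1 < c)
    (h : cornerLength a b c ≤ M) : 1 + 1 / Real.cosh M ^ 2 ≤ b ^ 2 := by
  have hb2 := Real.sqrt_pos.2 (sq_sub_one_pos hb)
  have h1 : b / √(b ^ 2 - 1) ≤ Real.cosh M :=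
    (div_sqrt_le_cosh_cornerLength ha hb hc).trans
      (Real.cosh_le_cosh.2 (abs_le_abs_of_nonneg (cornerLength_pos ha hb hc).le h))
  rw [div_le_iff₀ hb2] at h1
  have hM := Real.cosh_pos M
  have h2 : b ^ 2 ≤ Real.cosh M ^ 2 * (b ^ 2 - 1) := by
    rw [← Real.sq_sqrt (sq_sub_one_pos hb).le, ← mul_pow]
    exact pow_le_pow_left₀ (by linarith) h1 2
  have h3 : 1 / Real.cosh M ^ 2 ≤ b ^ 2 - 1 := by
    rw [div_le_iff₀ (by positivity)]
    nlinarith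
  linarith

/-- The ratio `a / (b * c)` is of interest because under vertex scaling it depends, up to bounded
factors, only on the conformal factor at this black side. -/
theorem div_mul_le_cosh_cornerLength {a b c : ℝ} (ha : 1 < a) (hb : 1 < b) (hc : 1 < c) :
    a / (b * c) ≤ Real.cosh (cornerLength a b c) := by
  have hb2 := sq_sub_one_pos hb
  have hc2 := sq_sub_one_pos hc
  rw [cosh_cornerLength ha hb hc]
  gcongr
  · exact le_add_of_nonneg_left (by positivity)
  · rw [Real.sqrt_le_iff]
    refine ⟨by positivity, ?_⟩
    rw [mul_pow]
    gcongr <;> linarith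

/-- A bound of a black side in terms of the parameters `X = cosh² (x / 2)` of the red sides. -/
theorem cosh_cornerLength_le {X Y Z t : ℝ} (hX : 1 < X) (ht : 1 < t) (hY : t ≤ Y) (hZ : t ≤ Z) :
    Real.cosh (cornerLength (2 * X - 1) (2 * Y - 1) (2 * Z - 1)) ≤
      ((1 - t⁻¹)⁻¹) ^ 2 * (1 + X / (Y * Z)) := by
  have hY1 : 1 < Y := ht.trans_le hY
  have hZ1 : 1 < Z := ht.trans_le hZ
  have hY0 : 0 < Y - 1 := by linarith
  have hZ0 : 0 < Z - 1 := by linarith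
  rw [cosh_cornerLength (by linarith) (by linarith) (by linarith)]
  -- Replacing `Y` by `Y - 1` and `Z` by `Z - 1` under the root makes it a perfect square. The loss
  -- is the factors `Y / (Y - 1)` and `Z / (Z - 1)`, at most `(1 - t⁻¹)⁻¹` each.
  have h1 : 4 * ((Y - 1) * (Z - 1)) ≤ √(((2 * Y - 1) ^ 2 - 1) * ((2 * Z - 1) ^ 2 - 1)) := by
    refine Real.le_sqrt_of_sq_le ?_
    have e1 : (2 * Y - 1) ^ 2 - 1 = 4 * (Y * (Y - 1)) := by ring
    have e2 : (2 * Z - 1) ^ 2 - 1 = 4 * (Z * (Z - 1)) := by ring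
    calc (4 * ((Y - 1) * (Z - 1))) ^ 2 = (4 * ((Y - 1) * (Y - 1))) * (4 * ((Z - 1) * (Z - 1))) := by
          ring
      _ ≤ (4 * (Y * (Y - 1))) * (4 * (Z * (Z - 1))) := by
          gcongr <;> linarith
      _ = _ := by rw [e1, e2]
  have key : ∀ {y : ℝ}, t ≤ y → y / (y - 1) ≤ (1 - t⁻¹)⁻¹ := by
    intro y hy
    have hy1 : 1 < y := ht.trans_le hy
    have e : y / (y - 1) = (1 - y⁻¹)⁻¹ := by
      have : y - 1 ≠ 0 := by linarith
      rw [← inv_div]; congr 1; field_simp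
    rw [e]
    have h2 : 0 < 1 - t⁻¹ := sub_pos.2 (inv_lt_one_of_one_lt₀ ht)
    gcongr
  calc ((2 * Y - 1) * (2 * Z - 1) + (2 * X - 1)) / √(((2 * Y - 1) ^ 2 - 1) * ((2 * Z - 1) ^ 2 - 1))
      ≤ (4 * (Y * Z + X)) / (4 * ((Y - 1) * (Z - 1))) := by
        gcongr
        nlinarith
    _ = (Y / (Y - 1)) * (Z / (Z - 1)) * (1 + X / (Y * Z)) := by field_simp
    _ ≤ (1 - t⁻¹)⁻¹ * (1 - t⁻¹)⁻¹ * (1 + X / (Y * Z)) := by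
        have := key hY
        have := key hZ
        have : 0 < 1 - t⁻¹ := sub_pos.2 (inv_lt_one_of_one_lt₀ ht)
        gcongr
    _ = _ := by ring

namespace IdealTriangulation

variable {F : Type*} (T : IdealTriangulation F) (lt : T.Edge → ℝ)

/-! ### Vertex scaling in terms of hyperbolic cosines -/

instance [Finite F] : Finite T.Edge :=
  Finite.of_surjective T.edge Quot.mk_surjective

/-- The square of `cosh (l / 2)` for the metric `l = w * lt`. -/
noncomputable def coshSq (w : T.Boundary → ℝ) (e : T.Edge) : ℝ :=
  (Real.exp (T.endSum w e) * Real.cosh (lt e / 2)) ^ 2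

theorem endSum_edge (w : T.Boundary → ℝ) (c : F × Fin 3) : T.endSum w (T.edge c) =
    w (T.component (c.1, c.2 + 1)) + w (T.component (c.1, c.2 + 2)) := rfl

theorem endSum_linear (a b : ℝ) (w v : T.Boundary → ℝ) (e : T.Edge) :
    T.endSum (a • w + b • v) e = a * T.endSum w e + b * T.endSum v e := by
  obtain ⟨c, rfl⟩ := Quot.mk_surjective e
  change T.endSum _ (T.edge c) = a * T.endSum _ (T.edge c) + b * T.endSum _ (T.edge c)
  simp only [endSum_edge, Pi.add_apply, Pi.smul_apply, smul_eq_mul]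
  ring

theorem contDiff_endSum [Fintype F] (e : T.Edge) {n : WithTop ℕ∞} :
    ContDiff ℝ n fun w => T.endSum w e := by
  obtain ⟨c, rfl⟩ := Quot.mk_surjective e
  change ContDiff ℝ n fun w => T.endSum w (T.edge c)
  simp only [endSum_edge]
  fun_prop

variable {lt}

theorem mem_admissible_iff {w : T.Boundary → ℝ} :
    w ∈ T.admissible lt ↔ ∀ e, 1 < Real.exp (T.endSum w e) * Real.cosh (lt e / 2) := by
  constructor
  · rintro ⟨l, hl, h⟩ e
    rw [← h e, Real.one_lt_cosh]
    have := hl e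
    positivity
  · intro h
    refine ⟨T.scale lt w, fun e => ?_, fun e => ?_⟩
    · exact mul_pos two_pos (Real.arcosh_pos (h e))
    · rw [scale, mul_div_cancel_left₀ _ two_ne_zero, Real.cosh_arcosh (h e).le]

theorem one_lt_coshSq {w : T.Boundary → ℝ} (hw : w ∈ T.admissible lt) (e : T.Edge) :
    1 < T.coshSq lt w e :=
  one_lt_pow₀ (T.mem_admissible_iff.1 hw e) two_ne_zero

theorem mem_admissible_of_one_lt_coshSq {w : T.Boundary → ℝ}
    (hw : ∀ e, 1 < T.coshSq lt w e) : w ∈ T.admissible lt :=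
  T.mem_admissible_iff.2 fun e => (one_lt_sq_iff₀ (by positivity)).1 (hw e)

theorem scale_pos {w : T.Boundary → ℝ} (hw : w ∈ T.admissible lt) (e : T.Edge) :
    0 < T.scale lt w e :=
  ((isVertexScaling_iff_eq_scale hw).2 rfl).1 e

theorem cosh_scale {w : T.Boundary → ℝ} (hw : w ∈ T.admissible lt) (e : T.Edge) :
    Real.cosh (T.scale lt w e) = 2 * T.coshSq lt w e - 1 := by
  rw [scale, Real.cosh_two_mul, Real.sinh_sq, Real.cosh_arcosh (T.mem_admissible_iff.1 hw e).le,
    coshSq]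
  ring

theorem coshSq_edge (w : T.Boundary → ℝ) (c : F × Fin 3) : T.coshSq lt w (T.edge c) =
    Real.exp (2 * w (T.component (c.1, c.2 + 1))) * Real.exp (2 * w (T.component (c.1, c.2 + 2))) *
      Real.cosh (lt (T.edge c) / 2) ^ 2 := by
  rw [coshSq, endSum_edge, mul_pow, ← Real.exp_nat_mul, ← Real.exp_add]
  congr 2
  push_cast
  ring

theorem hasDerivAt_coshSq (w v : T.Boundary → ℝ) (e : T.Edge) :
    HasDerivAt (fun τ : ℝ => T.coshSq lt (w + τ • v) e)
      (2 * T.endSum v e * T.coshSq lt w e) 0 := by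
  have h1 : HasDerivAt (fun τ : ℝ => T.endSum w e + τ * T.endSum v e) (T.endSum v e) 0 := by
    simpa using ((hasDerivAt_id (0 : ℝ)).mul_const (T.endSum v e)).const_add (T.endSum w e)
  have h2 := (h1.exp.mul_const (Real.cosh (lt e / 2))).pow 2
  have e1 : (fun τ : ℝ => T.coshSq lt (w + τ • v) e) =
      fun τ => (Real.exp (T.endSum w e + τ * T.endSum v e) * Real.cosh (lt e / 2)) ^ 2 := by
    funext τ
    have := T.endSum_linear 1 τ w v e
    rw [one_smul, one_mul] at this
    rw [coshSq, this]
  rw [e1]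
  refine h2.congr_deriv ?_
  simp only [coshSq, zero_mul, add_zero]
  ring

/-- The length of the black side `c` of the metric `w * lt`. -/
noncomputable def sideLength (lt : T.Edge → ℝ) (w : T.Boundary → ℝ) (c : F × Fin 3) : ℝ :=
  cornerLength (2 * T.coshSq lt w (T.edge c) - 1) (2 * T.coshSq lt w (T.edge (c.1, c.2 + 1)) - 1)
    (2 * T.coshSq lt w (T.edge (c.1, c.2 + 2)) - 1)

theorem one_lt_two_mul_coshSq_sub_one {w : T.Boundary → ℝ} (hw : w ∈ T.admissible lt)
    (e : T.Edge) : 1 < 2 * T.coshSq lt w e - 1 := by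
  linarith [T.one_lt_coshSq hw e]

theorem sideLength_pos {w : T.Boundary → ℝ} (hw : w ∈ T.admissible lt) (c : F × Fin 3) :
    0 < T.sideLength lt w c :=
  cornerLength_pos (T.one_lt_two_mul_coshSq_sub_one hw _)
    (T.one_lt_two_mul_coshSq_sub_one hw _) (T.one_lt_two_mul_coshSq_sub_one hw _)

theorem admissible_eq : T.admissible lt = {w | ∀ e, 1 < T.coshSq lt w e} :=
  Set.ext fun _ => ⟨fun hw => T.one_lt_coshSq hw, T.mem_admissible_of_one_lt_coshSq⟩

/-- The weight of the hexagon `f` in the Jacobian matrix of the curvature. -/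
noncomputable def hexagonWeight (lt : T.Edge → ℝ) (w : T.Boundary → ℝ) (f : F) : ℝ :=
  2 * (√(hexagonGram (2 * T.coshSq lt w (T.edge (f, 0)) - 1)
    (2 * T.coshSq lt w (T.edge (f, 1)) - 1) (2 * T.coshSq lt w (T.edge (f, 2)) - 1)))⁻¹

theorem hexagonWeight_pos {w : T.Boundary → ℝ} (hw : w ∈ T.admissible lt) (f : F) :
    0 < T.hexagonWeight lt w f := by
  have := hexagonGram_pos (T.one_lt_two_mul_coshSq_sub_one hw (T.edge (f, 0)))
    (T.one_lt_two_mul_coshSq_sub_one hw (T.edge (f, 1)))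
    (T.one_lt_two_mul_coshSq_sub_one hw (T.edge (f, 2)))
  rw [hexagonWeight]
  positivity

/-- The Gram expression is invariant under cyclic permutation, so the three corners of a face share
one weight. -/
theorem hexagonWeight_eq (w : T.Boundary → ℝ) (c : F × Fin 3) : T.hexagonWeight lt w c.1 =
    2 * (√(hexagonGram (2 * T.coshSq lt w (T.edge c) - 1)
      (2 * T.coshSq lt w (T.edge (c.1, c.2 + 1)) - 1)
      (2 * T.coshSq lt w (T.edge (c.1, c.2 + 2)) - 1)))⁻¹ := by
  obtain ⟨f, k⟩ := c
  rw [hexagonWeight]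
  congr 3
  fin_cases k <;> simp [hexagonGram] <;> ring

/-- Admissibility is a system of strict linear inequalities in `w`, one for each edge. -/
theorem convex_admissible : Convex ℝ (T.admissible lt) := by
  have key : ∀ {w : T.Boundary → ℝ}, w ∈ T.admissible lt ↔
      ∀ e, T.endSum w e ∈ Set.Ioi (-Real.log (Real.cosh (lt e / 2))) := by
    intro w
    rw [mem_admissible_iff]
    refine forall_congr' fun e => ?_
    rw [Set.mem_Ioi, ← Real.exp_lt_exp (y := T.endSum w e), Real.exp_neg, Real.exp_log (Real.cosh_pos _),
      inv_lt_iff_one_lt_mul₀ (Real.cosh_pos _)]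
  intro w hw v hv a b ha hb hab
  rw [key] at *
  intro e
  rw [endSum_linear]
  exact convex_Ioi _ (hw e) (hv e) ha hb hab

theorem zero_mem_admissible (hlt : ∀ e, 0 < lt e) : 0 ∈ T.admissible lt := by
  rw [mem_admissible_iff]
  intro e
  have := T.endSum_linear 0 0 0 0 e
  rw [zero_smul, add_zero, zero_mul, add_zero] at this
  rw [this, Real.exp_zero, one_mul, Real.one_lt_cosh]
  have := hlt e
  positivity

/-- For `a = 2 cosh²(l/2) - 1` the variation is `a' = 2 (a + 1) * endSum v`. In the derivative
cosine law the factors `b + 1` and `c + 1` cancel against `b² - 1` and `c² - 1`, leaving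
`cornerVariation`. -/
theorem hasDerivAt_sideLength {w : T.Boundary → ℝ} (hw : w ∈ T.admissible lt)
    (v : T.Boundary → ℝ) (c : F × Fin 3) :
    HasDerivAt (fun τ : ℝ => T.sideLength lt (w + τ • v) c)
      (-(T.hexagonWeight lt w c.1 * cornerVariation (2 * T.coshSq lt w (T.edge c) - 1)
        (2 * T.coshSq lt w (T.edge (c.1, c.2 + 1)) - 1)
        (2 * T.coshSq lt w (T.edge (c.1, c.2 + 2)) - 1) (v (T.component c))
        (v (T.component (c.1, c.2 + 1))) (v (T.component (c.1, c.2 + 2))))) 0 := by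
  have h : ∀ e, HasDerivAt (fun τ : ℝ => 2 * T.coshSq lt (w + τ • v) e - 1)
      (2 * (2 * T.endSum v e * T.coshSq lt w e)) 0 := fun e =>
    ((T.hasDerivAt_coshSq w v e).const_mul 2).sub_const 1
  have h1 : ∀ e, 1 < 2 * T.coshSq lt (w + (0 : ℝ) • v) e - 1 := fun e => by
    rw [zero_smul, add_zero]; exact T.one_lt_two_mul_coshSq_sub_one hw e
  have h2 := (h (T.edge c)).cornerLength (h (T.edge (c.1, c.2 + 1)))
    (h (T.edge (c.1, c.2 + 2))) (h1 _) (h1 _) (h1 _)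
  refine h2.congr_deriv ?_
  rw [hexagonWeight_eq]
  have e1 : c.2 + 1 + 2 = c.2 := by rw [add_assoc]; exact add_zero _
  have e2 : c.2 + 2 + 1 = c.2 := by rw [add_assoc]; exact add_zero _
  have e3 : c.2 + 1 + 1 = c.2 + 2 := add_assoc _ _ _
  have e4 : c.2 + 2 + 2 = c.2 + 1 := add_assoc _ _ _
  simp only [zero_smul, add_zero, endSum_edge, e1, e2, e3, e4, Prod.mk.eta]
  have hB := T.one_lt_coshSq hw (T.edge (c.1, c.2 + 1))
  have hC := T.one_lt_coshSq hw (T.edge (c.1, c.2 + 2))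
  generalize T.coshSq lt w (T.edge (c.1, c.2 + 1)) = B at *
  generalize T.coshSq lt w (T.edge (c.1, c.2 + 2)) = C at *
  generalize T.coshSq lt w (T.edge c) = A at *
  have b1 : B - 1 ≠ 0 := by linarith
  have c1 : C - 1 ≠ 0 := by linarith
  have b0 : B ≠ 0 := by linarith
  have c0 : C ≠ 0 := by linarith
  have f1 : (2 * B - 1) ^ 2 - 1 = 4 * B * (B - 1) := by ring
  have f2 : (2 * C - 1) ^ 2 - 1 = 4 * C * (C - 1) := by ring
  have f3 : 2 * B - 1 - 1 = 2 * (B - 1) := by ring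
  have f4 : 2 * C - 1 - 1 = 2 * (C - 1) := by ring
  rw [f1, f2, cornerVariation, f3, f4]
  field_simp
  ring

variable [Fintype F]

open Classical in
theorem K_eq_sum_sideLength {w : T.Boundary → ℝ} (hw : w ∈ T.admissible lt) (i : T.Boundary) :
    T.K lt w i = ∑ c : F × Fin 3 with T.component c = i, T.sideLength lt w c := by
  rw [K, curvature]
  refine Finset.sum_congr rfl fun c _ => ?_
  rw [arcLength_eq_cornerLength (T.scale_pos hw _) (T.scale_pos hw _) (T.scale_pos hw _),
    T.cosh_scale hw, T.cosh_scale hw, T.cosh_scale hw, sideLength]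

theorem sideLength_le_K {w : T.Boundary → ℝ} (hw : w ∈ T.admissible lt) (c : F × Fin 3) :
    T.sideLength lt w c ≤ T.K lt w (T.component c) := by
  classical
  rw [T.K_eq_sum_sideLength hw]
  exact Finset.single_le_sum (f := T.sideLength lt w) (fun c _ => (T.sideLength_pos hw c).le)
    (by simp)

theorem K_pos {w : T.Boundary → ℝ} (hw : w ∈ T.admissible lt) (i : T.Boundary) :
    0 < T.K lt w i := by
  obtain ⟨c, rfl⟩ := Quot.mk_surjective i
  exact (T.sideLength_pos hw c).trans_le (T.sideLength_le_K hw c)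

theorem continuous_coshSq (e : T.Edge) : Continuous fun w => T.coshSq lt w e :=
  (((Real.contDiff_exp.comp (T.contDiff_endSum e (n := 0))).mul contDiff_const).pow 2).continuous

theorem isOpen_admissible : IsOpen (T.admissible lt) := by
  rw [admissible_eq, Set.ofPred_forall]
  exact isOpen_iInter_of_finite fun e => isOpen_lt continuous_const (T.continuous_coshSq e)

theorem contDiffOn_sideLength (c : F × Fin 3) {n : WithTop ℕ∞} :
    ContDiffOn ℝ n (fun w => T.sideLength lt w c) (T.admissible lt) := by
  have h : ∀ e, ContDiffOn ℝ n (fun w => 2 * T.coshSq lt w e - 1) (T.admissible lt) := fun e =>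
    ((contDiff_const.mul (((Real.contDiff_exp.comp (T.contDiff_endSum e)).mul
      contDiff_const).pow 2)).sub contDiff_const).contDiffOn
  exact (h _).cornerLength (h _) (h _) (fun w hw => T.one_lt_two_mul_coshSq_sub_one hw _)
    (fun w hw => T.one_lt_two_mul_coshSq_sub_one hw _)
    (fun w hw => T.one_lt_two_mul_coshSq_sub_one hw _)

theorem contDiffOn_K {n : WithTop ℕ∞} : ContDiffOn ℝ n (T.K lt) (T.admissible lt) := by
  classical
  rw [contDiffOn_pi]
  intro i
  exact (ContDiffOn.sum fun c _ => T.contDiffOn_sideLength c).congr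
    fun w hw => T.K_eq_sum_sideLength hw i

/-! ### The Jacobian matrix -/

/-- Each corner contributes to exactly one boundary component, so the sum over components and their
corners can be regrouped by faces. -/
theorem dotProduct_jacobian_mulVec {w : T.Boundary → ℝ} (hw : w ∈ T.admissible lt)
    (u v : T.Boundary → ℝ) : u ⬝ᵥ (-jacobian (T.K lt) w) *ᵥ v =
      ∑ f, T.hexagonWeight lt w f * hexagonForm (fun k => 2 * T.coshSq lt w (T.edge (f, k)) - 1)
        (fun k => u (T.component (f, k))) (fun k => v (T.component (f, k))) := by
  classical
  have hdiff : HasFDerivAt (T.K lt) (fderiv ℝ (T.K lt) w) w :=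
    ((T.contDiffOn_K (n := 1)).differentiableOn one_ne_zero |>.differentiableAt
      (T.isOpen_admissible.mem_nhds hw)).hasFDerivAt
  have hline := hasDerivAt_add_smul w v 0
  have hK : HasDerivAt (fun τ : ℝ => T.K lt (w + τ • v)) (fderiv ℝ (T.K lt) w v) 0 := by
    have hdiff' : HasFDerivAt (T.K lt) (fderiv ℝ (T.K lt) w) (w + (0 : ℝ) • v) := by
      rwa [zero_smul, add_zero]
    exact hdiff'.comp_hasDerivAt (0 : ℝ) hline
  -- The formula for `K` as a sum of `sideLength` holds only at admissible points, hence for small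
  -- `τ`.
  have hmem : ∀ᶠ τ : ℝ in nhds 0, w + τ • v ∈ T.admissible lt :=
    hline.continuousAt.eventually (by
      simpa using T.isOpen_admissible.mem_nhds hw)
  have hi : ∀ i, fderiv ℝ (T.K lt) w v i = ∑ c : F × Fin 3 with T.component c = i, _ := fun i =>
    (hasDerivAt_pi.1 hK i).unique ((HasDerivAt.fun_sum fun c _ =>
      T.hasDerivAt_sideLength hw v c).congr_of_eventuallyEq
        (hmem.mono fun τ hτ => T.K_eq_sum_sideLength hτ i))
  rw [Matrix.neg_mulVec, dotProduct_neg, jacobian_mulVec, dotProduct]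
  simp only [hi, Finset.mul_sum]
  have : ∀ i, ∀ c ∈ Finset.univ.filter fun c => T.component c = i, ∀ x : ℝ,
      u i * -x = u (T.component c) * -x := by
    intro i c hc x
    rw [(Finset.mem_filter.1 hc).2]
  rw [Finset.sum_congr rfl fun i _ => Finset.sum_congr rfl fun c hc => this i c hc _,
    Finset.sum_fiberwise, Fintype.sum_prod_type, ← Finset.sum_neg_distrib]
  refine Finset.sum_congr rfl fun f _ => ?_
  rw [hexagonForm, Finset.mul_sum, ← Finset.sum_neg_distrib]
  refine Finset.sum_congr rfl fun k _ => ?_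
  ring

/-- Both properties are inherited from the single hexagons. Every boundary component contains a
corner, so a nonzero `v` is nonzero on some hexagon. -/
theorem posDef_neg_jacobian {w : T.Boundary → ℝ} (hw : w ∈ T.admissible lt) :
    (-jacobian (T.K lt) w).PosDef := by
  have hc : ∀ f k, 1 < 2 * T.coshSq lt w (T.edge (f, k)) - 1 := fun f k =>
    T.one_lt_two_mul_coshSq_sub_one hw _
  refine Matrix.PosDef.of_dotProduct_mulVec_pos ?_ fun v hv => ?_
  · ext i j
    have h : ∀ i j, (-jacobian (T.K lt) w) i j =
        Pi.single i 1 ⬝ᵥ (-jacobian (T.K lt) w) *ᵥ Pi.single j 1 := fun i j => by simp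
    rw [Matrix.conjTranspose_apply, star_trivial, h, h i j, T.dotProduct_jacobian_mulVec hw,
      T.dotProduct_jacobian_mulVec hw]
    refine Finset.sum_congr rfl fun f _ => ?_
    rw [hexagonForm_comm (hc f)]
  · rw [star_trivial, T.dotProduct_jacobian_mulVec hw]
    obtain ⟨i, hi⟩ := Function.ne_iff.1 hv
    obtain ⟨⟨f, k⟩, rfl⟩ := Quot.mk_surjective i
    refine Finset.sum_pos' (fun g _ => mul_nonneg (T.hexagonWeight_pos hw g).le ?_)
      ⟨f, Finset.mem_univ f, mul_pos (T.hexagonWeight_pos hw f) (hexagonForm_self_pos (hc f) ?_)⟩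
    · by_cases h : (fun k => v (T.component (g, k))) = 0
      · rw [h]; simp [hexagonForm]
      · exact (hexagonForm_self_pos (hc g) h).le
    · exact Function.ne_iff.2 ⟨k, hi⟩

end IdealTriangulation

namespace IdealTriangulation

variable {F : Type*} (T : IdealTriangulation F) {lt : T.Edge → ℝ}

/-! ### Properness of the curvature -/

/-- The two edges in the denominator both end at the corner `c`, while the edge in the numerator
joins the other two corners. The factors of those corners cancel and only that of `c` survives. -/
theorem coshSq_div (w : T.Boundary → ℝ) (c : F × Fin 3) :
    T.coshSq lt w (T.edge c) /
        (T.coshSq lt w (T.edge (c.1, c.2 + 1)) * T.coshSq lt w (T.edge (c.1, c.2 + 2))) =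
      Real.exp (-(4 * w (T.component c))) * (Real.cosh (lt (T.edge c) / 2) ^ 2 /
        (Real.cosh (lt (T.edge (c.1, c.2 + 1)) / 2) ^ 2 *
          Real.cosh (lt (T.edge (c.1, c.2 + 2)) / 2) ^ 2)) := by
  have e1 : c.2 + 1 + 2 = c.2 := by rw [add_assoc]; exact add_zero _
  have e2 : c.2 + 2 + 1 = c.2 := by rw [add_assoc]; exact add_zero _
  have e3 : c.2 + 1 + 1 = c.2 + 2 := add_assoc _ _ _
  have e4 : c.2 + 2 + 2 = c.2 + 1 := add_assoc _ _ _
  have e5 : Real.exp (-(4 * w (T.component c))) =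
      (Real.exp (2 * w (T.component c)) ^ 2)⁻¹ := by
    rw [← Real.exp_nat_mul, ← Real.exp_neg]
    congr 1
    push_cast
    ring
  simp only [coshSq_edge, e1, e2, e3, e4, Prod.mk.eta, e5]
  have h1 := Real.exp_pos (2 * w (T.component (c.1, c.2 + 1)))
  have h2 := Real.exp_pos (2 * w (T.component (c.1, c.2 + 2)))
  have h3 := Real.exp_pos (2 * w (T.component c))
  have h4 := Real.cosh_pos (lt (T.edge (c.1, c.2 + 1)) / 2)
  have h5 := Real.cosh_pos (lt (T.edge (c.1, c.2 + 2)) / 2)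
  field_simp

/-- An upper bound of a black side gives a lower bound of the conformal factor. -/
theorem exp_le_of_sideLength_le {w : T.Boundary → ℝ} (hw : w ∈ T.admissible lt) {B M : ℝ}
    (hB : ∀ e, Real.cosh (lt e / 2) ^ 2 ≤ B) {c : F × Fin 3} (h : T.sideLength lt w c ≤ M) :
    Real.exp (-(4 * w (T.component c))) ≤ 4 * B ^ 2 * Real.cosh M := by
  set X := T.coshSq lt w (T.edge c) with hX
  set Y := T.coshSq lt w (T.edge (c.1, c.2 + 1)) with hY
  set Z := T.coshSq lt w (T.edge (c.1, c.2 + 2)) with hZ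
  have hX1 : 1 < X := T.one_lt_coshSq hw _
  have hY1 : 1 < Y := T.one_lt_coshSq hw _
  have hZ1 : 1 < Z := T.one_lt_coshSq hw _
  have h1 := div_mul_le_cosh_cornerLength (a := 2 * X - 1) (b := 2 * Y - 1) (c := 2 * Z - 1)
    (by linarith) (by linarith) (by linarith)
  have h2 : Real.cosh (cornerLength (2 * X - 1) (2 * Y - 1) (2 * Z - 1)) ≤ Real.cosh M :=
    Real.cosh_le_cosh.2 (abs_le_abs_of_nonneg (T.sideLength_pos hw c).le h)
  -- Uses `X ≤ 2X - 1` in the numerator and `2Y - 1 ≤ 2Y`, `2Z - 1 ≤ 2Z` in the denominator.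
  have h3 : X / (Y * Z) / 4 ≤ (2 * X - 1) / ((2 * Y - 1) * (2 * Z - 1)) := by
    rw [div_div, div_le_div_iff₀ (by positivity)
      (mul_pos (by linarith) (by linarith))]
    have : (2 * Y - 1) * (2 * Z - 1) ≤ 4 * (Y * Z) := by nlinarith
    calc X * ((2 * Y - 1) * (2 * Z - 1)) ≤ X * (4 * (Y * Z)) := by gcongr
      _ ≤ (2 * X - 1) * (Y * Z * 4) := by
        have : 0 < (X - 1) * (Y * Z * 4) := mul_pos (by linarith) (by positivity)
        nlinarith
  have h4 : Real.exp (-(4 * w (T.component c))) / B ^ 2 ≤ X / (Y * Z) := by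
    rw [hX, hY, hZ, coshSq_div, div_eq_mul_one_div]
    have hc : ∀ e, 1 ≤ Real.cosh (lt e / 2) ^ 2 := fun e => one_le_pow₀ (Real.one_le_cosh _)
    have hB0 : 0 < B := zero_lt_one.trans_le ((hc (T.edge c)).trans (hB _))
    have := Real.cosh_pos (lt (T.edge (c.1, c.2 + 1)) / 2)
    have := Real.cosh_pos (lt (T.edge (c.1, c.2 + 2)) / 2)
    gcongr
    · exact hc _
    · rw [sq B]
      exact mul_le_mul (hB _) (hB _) (by positivity) hB0.le
  have hB1 : 0 < B := (pow_pos (Real.cosh_pos _) 2).trans_le (hB (T.edge c))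
  have h5 : Real.exp (-(4 * w (T.component c))) / B ^ 2 ≤ 4 * Real.cosh M := by linarith
  rw [div_le_iff₀ (by positivity)] at h5
  linarith

/-- A black side is small if its conformal factor is large, when the others are bounded below. -/
theorem cosh_sideLength_le {w : T.Boundary → ℝ} (hw : w ∈ T.admissible lt) {B L : ℝ}
    (hB : ∀ e, Real.cosh (lt e / 2) ^ 2 ≤ B) (hL : ∀ i, -L ≤ w i) {c : F × Fin 3}
    (hc : L < w (T.component c)) : Real.cosh (T.sideLength lt w c) ≤
      ((1 - Real.exp (-(2 * (w (T.component c) - L))))⁻¹) ^ 2 *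
        (1 + Real.exp (-(4 * w (T.component c))) * B) := by
  have hcosh : ∀ e, 1 ≤ Real.cosh (lt e / 2) ^ 2 := fun e => one_le_pow₀ (Real.one_le_cosh _)
  have e1 : c.2 + 1 + 2 = c.2 := by rw [add_assoc]; exact add_zero _
  have e2 : c.2 + 2 + 1 = c.2 := by rw [add_assoc]; exact add_zero _
  have e3 : c.2 + 1 + 1 = c.2 + 2 := add_assoc _ _ _
  have e4 : c.2 + 2 + 2 = c.2 + 1 := add_assoc _ _ _
  -- Both red sides adjacent to `c` have `coshSq` at least `t = exp (2 (w c - L))`, and `t > 1`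
  -- since `L < w c`.
  have key : ∀ i, Real.exp (2 * (w (T.component c) - L)) ≤
      Real.exp (2 * w (T.component c)) * Real.exp (2 * w i) := fun i => by
    rw [← Real.exp_add]
    exact Real.exp_le_exp.2 (by linarith [hL i])
  have h := cosh_cornerLength_le (X := T.coshSq lt w (T.edge c))
    (Y := T.coshSq lt w (T.edge (c.1, c.2 + 1))) (Z := T.coshSq lt w (T.edge (c.1, c.2 + 2)))
    (t := Real.exp (2 * (w (T.component c) - L))) (T.one_lt_coshSq hw _)
    (Real.one_lt_exp_iff.2 (by linarith))
    (by
      rw [coshSq_edge]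
      simp only [e1, e3, Prod.mk.eta]
      rw [mul_comm (Real.exp (2 * w (T.component (c.1, c.2 + 2))))]
      exact (key _).trans (le_mul_of_one_le_right (by positivity) (hcosh _)))
    (by
      rw [coshSq_edge]
      simp only [e2, e4, Prod.mk.eta]
      exact (key _).trans (le_mul_of_one_le_right (by positivity) (hcosh _)))
  rw [coshSq_div, ← Real.exp_neg] at h
  refine h.trans ?_
  gcongr
  refine (div_le_self (by positivity) ?_).trans (hB _)
  exact one_le_mul_of_one_le_of_one_le (hcosh _) (hcosh _)

variable [Fintype F]

/-- An upper bound on the black sides bounds every red side below, so `w` stays a fixed amount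
inside the domain; a norm bound then gives compactness. -/
theorem exists_compact_of_K_le (M R : ℝ) : ∃ Q ⊆ T.admissible lt, IsCompact Q ∧
    ∀ w ∈ T.admissible lt, (∀ i, T.K lt w i ≤ M) → ‖w‖ ≤ R → w ∈ Q := by
  -- Obtained by solving `2X - 1 ≥ √(1 + 1 / cosh² M)` for `X = coshSq`.
  set δ := (1 + √(1 + 1 / Real.cosh M ^ 2)) / 2 with hδ
  have hM := Real.cosh_pos M
  have hδ1 : 1 < δ := by
    have : 1 < √(1 + 1 / Real.cosh M ^ 2) := by
      rw [Real.lt_sqrt zero_le_one]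
      have : 0 < 1 / Real.cosh M ^ 2 := by positivity
      linarith
    linarith
  refine ⟨{w | ∀ e, δ ≤ T.coshSq lt w e} ∩ Metric.closedBall 0 R,
    fun w hw => T.mem_admissible_of_one_lt_coshSq fun e => hδ1.trans_le (hw.1 e), ?_,
    fun w hw hK hwR => ⟨fun e => ?_, by rwa [mem_closedBall_zero_iff]⟩⟩
  · refine (isCompact_closedBall _ _).inter_left ?_
    rw [Set.ofPred_forall]
    exact isClosed_iInter fun e => isClosed_le continuous_const (T.continuous_coshSq e)
  · obtain ⟨⟨f, k⟩, rfl⟩ := Quot.mk_surjective e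
    -- The black side `k + 2` is adjacent to the red side `k`, because `k + 2 + 1 = k` modulo three.
    have h1 : T.sideLength lt w (f, k + 2) ≤ M :=
      (T.sideLength_le_K hw _).trans (hK _)
    have h2 := le_sq_of_cornerLength_le (T.one_lt_two_mul_coshSq_sub_one hw _)
      (T.one_lt_two_mul_coshSq_sub_one hw _) (T.one_lt_two_mul_coshSq_sub_one hw _) h1
    have e2 : k + 2 + 1 = k := by rw [add_assoc]; exact add_zero _
    simp only [e2] at h2
    have h3 := Real.sqrt_le_iff.2
      ⟨(zero_lt_one.trans (T.one_lt_two_mul_coshSq_sub_one hw (T.edge (f, k)))).le, h2⟩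
    change δ ≤ T.coshSq lt w (T.edge (f, k))
    linarith

theorem exists_bound_cosh_sq (lt : T.Edge → ℝ) : ∃ B, ∀ e, Real.cosh (lt e / 2) ^ 2 ≤ B := by
  obtain ⟨B, hB⟩ := (Set.finite_range fun e => Real.cosh (lt e / 2) ^ 2).bddAbove
  exact ⟨B, fun e => hB ⟨e, rfl⟩⟩

/-- If one factor is very large and all are at least `-L`, every black side of its component is
short, and a component with boundedly many short sides is shorter than `m`. -/
theorem exists_forall_lt_of_le_K {m : ℝ} (hm : 0 < m) (L : ℝ) :
    ∃ H, ∀ w ∈ T.admissible lt, (∀ i, -L ≤ w i) → (∀ i, m ≤ T.K lt w i) → ∀ i, w i < H := by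
  classical
  obtain ⟨B, hB⟩ := T.exists_bound_cosh_sq lt
  have hlim : Filter.Tendsto (fun y : ℝ => ((1 - Real.exp (-(2 * (y - L))))⁻¹) ^ 2 *
      (1 + Real.exp (-(4 * y)) * B)) Filter.atTop (nhds 1) := by
    have h1 : Filter.Tendsto (fun y : ℝ => Real.exp (-(2 * (y - L)))) Filter.atTop (nhds 0) :=
      Real.tendsto_exp_neg_atTop_nhds_zero.comp
        ((Filter.tendsto_atTop_add_const_right _ (-L) Filter.tendsto_id).const_mul_atTop two_pos)
    have h2 : Filter.Tendsto (fun y : ℝ => Real.exp (-(4 * y))) Filter.atTop (nhds 0) :=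
      Real.tendsto_exp_neg_atTop_nhds_zero.comp
        (Filter.tendsto_id.const_mul_atTop four_pos)
    have h3 := (((h1.const_sub 1).inv₀ (by norm_num)).pow 2).mul ((h2.mul_const B).const_add 1)
    simpa using h3
  -- The extra `1` makes the contradiction strict: fewer than `N` sides of length at most `m / N`
  -- add up to less than `m`.
  set N : ℝ := Fintype.card (F × Fin 3) + 1 with hN
  have hN0 : 0 < N := by positivity
  have hcosh : 1 < Real.cosh (m / N) := Real.one_lt_cosh.2 (by positivity)
  obtain ⟨H, hH⟩ := (((hlim.eventually_lt_const hcosh).and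
    (Filter.eventually_gt_atTop L))).exists_forall_of_atTop
  refine ⟨H, fun w hw hwL hK i => ?_⟩
  by_contra! hi
  obtain ⟨h1, h2⟩ := hH _ hi
  have hside : ∀ c ∈ Finset.univ.filter fun c => T.component c = i,
      T.sideLength lt w c ≤ m / N := by
    intro c hc
    obtain rfl := (Finset.mem_filter.1 hc).2
    have h3 := (T.cosh_sideLength_le hw hB hwL h2).trans h1.le
    rw [Real.cosh_le_cosh, abs_of_pos (T.sideLength_pos hw c), abs_of_pos (by positivity)] at h3
    exact h3
  have h4 := hK i
  rw [T.K_eq_sum_sideLength hw] at h4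
  have h5 := h4.trans (Finset.sum_le_card_nsmul _ _ _ hside)
  rw [nsmul_eq_mul, mul_div_assoc', le_div_iff₀ hN0, mul_comm, mul_le_mul_iff_left₀ hm] at h5
  have h6 : ((Finset.univ.filter fun c => T.component c = i).card : ℝ) ≤
      Fintype.card (F × Fin 3) := by exact_mod_cast Finset.card_le_univ _
  linarith

/-- The order matters: the upper bound on `K` bounds `w` below, and only with this bound does the
lower bound on `K` bound `w` above. -/
theorem exists_compact_of_K_mem_Icc {m : ℝ} (hm : 0 < m) (M : ℝ) :
    ∃ Q ⊆ T.admissible lt, IsCompact Q ∧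
      ∀ w ∈ T.admissible lt, (∀ i, T.K lt w i ∈ Set.Icc m M) → w ∈ Q := by
  obtain ⟨B, hB⟩ := T.exists_bound_cosh_sq lt
  set L := Real.log (4 * B ^ 2 * Real.cosh M) / 4 with hL
  obtain ⟨H, hH⟩ := T.exists_forall_lt_of_le_K (lt := lt) hm L
  obtain ⟨Q, hQW, hQ, hQ'⟩ := T.exists_compact_of_K_le (lt := lt) M (max |L| |H|)
  refine ⟨Q, hQW, hQ, fun w hw hK => hQ' w hw (fun i => (hK i).2) ?_⟩
  have hlow : ∀ i, -L ≤ w i := by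
    intro i
    obtain ⟨c, rfl⟩ := Quot.mk_surjective i
    have h1 := T.exp_le_of_sideLength_le hw hB ((T.sideLength_le_K hw c).trans (hK _).2)
    have h2 := (Real.le_log_iff_exp_le ((Real.exp_pos _).trans_le h1)).2 h1
    change -L ≤ w (T.component c)
    linarith
  refine (pi_norm_le_iff_of_nonneg (by positivity)).2 fun i => ?_
  rw [Real.norm_eq_abs, abs_le]
  have h1 := hlow i
  have h2 := hH w hw hlow (fun i => (hK i).1) i
  constructor
  · linarith [le_abs_self L, le_max_left |L| |H|]
  · linarith [le_abs_self H, le_max_right |L| |H|]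

theorem isCurvatureMap_K (hlt : ∀ e, 0 < lt e) :
    IsCurvatureMap (T.admissible lt) (T.K lt) where
  isOpen := T.isOpen_admissible
  convex := T.convex_admissible
  nonempty := ⟨0, T.zero_mem_admissible hlt⟩
  contDiffOn := T.contDiffOn_K
  pos := fun _ hw => T.K_pos hw
  posDef := fun _ hw => T.posDef_neg_jacobian hw
  exists_compact_of_mem_Icc := fun _ hm M => T.exists_compact_of_K_mem_Icc hm M
  exists_compact_of_le := T.exists_compact_of_K_le

end IdealTriangulation

/-! ### The exponents zero and one, and the main theorem -/

theorem matrixRpow_zero {ι : Type*} [Fintype ι] [DecidableEq ι] {A : Matrix ι ι ℝ}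
    (hA : A.IsHermitian) : matrixRpow A 0 = 1 := by
  obtain ⟨P, hP, d, h⟩ := exists_orthogonal_diagonal hA
  rw [matrixRpow_eq hP h]
  simp only [Real.rpow_zero, Matrix.diagonal_one, mul_one]
  exact (Matrix.mem_orthogonalGroup_iff' ι ℝ).1 hP

theorem matrixRpow_one {ι : Type*} [Fintype ι] [DecidableEq ι] {A : Matrix ι ι ℝ}
    (hA : A.IsHermitian) : matrixRpow A 1 = A := by
  obtain ⟨P, hP, d, h⟩ := exists_orthogonal_diagonal hA
  rw [matrixRpow_eq hP h]
  simp only [Real.rpow_one]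
  exact h.symm

theorem mainTheorem2 {F : Type*} [Fintype F] (T : IdealTriangulation F)
    (lt : T.Edge → ℝ) (hlt : ∀ e, 0 < lt e)
    (Kbar : T.Boundary → ℝ) (hKbar : ∀ i, 0 < Kbar i) :
    -- the Laplacian and its fractional powers are well defined on the admissible space
    (∀ w ∈ T.admissible lt,
      DifferentiableAt ℝ (T.K lt) w ∧ (-T.laplacian lt w).PosDef) ∧
    -- the cases `s = 0` and `s = 1` are the Yamabe flow and the Calabi flow
    (∀ w ∈ T.admissible lt,
      T.fractionalCalabiField lt Kbar 0 w = T.yamabeField lt Kbar w ∧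
      T.fractionalCalabiField lt Kbar 1 w = T.calabiField lt Kbar w) ∧
    -- there is a unique metric in the conformal class with boundary lengths `Kbar`
    ∃ wbar ∈ T.admissible lt, T.K lt wbar = Kbar ∧
      (∀ w ∈ T.admissible lt, T.K lt w = Kbar → w = wbar) ∧
      ∀ (s : ℝ), ∀ w₀ ∈ T.admissible lt, ∃ w : ℝ → T.Boundary → ℝ,
        -- the solution exists for all time and is unique
        T.IsFractionalCalabiFlow lt Kbar s w₀ (Set.Ici 0) w ∧
        (∀ (τ : ℝ) (v : ℝ → T.Boundary → ℝ), 0 < τ →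
          T.IsFractionalCalabiFlow lt Kbar s w₀ (Set.Ico 0 τ) v →
            ∀ t ∈ Set.Ico 0 τ, v t = w t) ∧
        -- it converges exponentially fast
        ∃ C > 0, ∃ c > 0, ∀ t ≥ 0, ‖w t - wbar‖ ≤ C * Real.exp (-c * t) := by
  have h := T.isCurvatureMap_K hlt
  have hlap : ∀ w, T.laplacian lt w = jacobian (T.K lt) w := fun _ => rfl
  have hfield : ∀ s w, T.fractionalCalabiField lt Kbar s w = fractionalField (T.K lt) Kbar s w :=
    fun _ _ => rfl
  obtain ⟨wbar, hwbar, hK⟩ := h.exists_eq hKbar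
  refine ⟨fun w hw => ⟨(h.hasFDerivAt hw).differentiableAt, h.posDef w hw⟩, fun w hw => ⟨?_, ?_⟩,
    wbar, hwbar, hK, fun w hw e => h.injOn hw hwbar (e.trans hK.symm), fun s w₀ hw₀ => ?_⟩
  · rw [hfield, fractionalField_eq, matrixRpow_zero (h.posDef w hw).isHermitian,
      Matrix.one_mulVec, IdealTriangulation.yamabeField]
  · rw [hfield, fractionalField, matrixRpow_one (h.posDef w hw).isHermitian, neg_neg,
      IdealTriangulation.calabiField, hlap]
  · obtain ⟨w, h0, hmem, hd, huniq, hexp⟩ := h.exists_flow hKbar hwbar hK s hw₀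
    refine ⟨w, ⟨h0, hmem, hd⟩, fun τ v _ hv t ht => ?_, hexp⟩
    -- Uniqueness on the half-open interval is tested on `[0, t]` for each `t < τ`, where the
    -- competitor is a curve on a closed interval.
    refine huniq t v hv.init (fun r hr => ?_) t ⟨ht.1, le_rfl⟩
    have hrτ : r ∈ Set.Ico 0 τ := ⟨hr.1, hr.2.trans_lt ht.2⟩
    exact ⟨hv.mem r hrτ, (hv.deriv r hrτ).mono (Set.Icc_subset_Ico_right ht.2)⟩
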